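/- Work in $3+1$ Minkowski space with $\hbar=c=1$. Let $\phi$ be the free massless real scalar field with mode expansion $\phi(\mathbf x,t)=\int \frac{d^3k}{\sqrt{(2\pi)^3\,2|\mathbf k|}}\big(a_{\mathbf k}e^{-i|\mathbf k|t+i\mathbf k\cdot\mathbf x}+\mathrm{h.c.}\big)$ on Fock space, $\langle\cdot\rangle$ the vacuum expectation, and, for a real Schwartz function $f$ on $\mathbb R^3$, $\phi[f](t)=\int d^3x\,f(\mathbf x)\phi(\mathbf x,t)$. Fix $\lambda,\Omega\in\mathbb R$ and $\sigma>0$, and let $\chi(t)=\frac{1}{\sqrt{2\pi\sigma^2}}e^{-t^2/(2\sigma^2)}$. Consider finitely many detectors with common energy gap $\Omega$, common switching function $\chi$, and smearing functions $f_i$. With $W_{ij}(t,t')=\langle\phi[f_i](t)\phi[f_j](t')\rangle$ and $\Theta$ the Heaviside function, put $$C_{ij}=\lambda^2\int dt\,dt'\,\chi(t)\chi(t')e^{-i\Omega(t-t')}W_{ij}(t,t'),\qquad P_i=C_{ii},$$ $$X_{ij}=-\lambda^2\int dt\,dt'\,\chi(t)\chi(t')e^{i\Omega(t+t')}\big(\Theta(t-t')W_{ij}(t,t')+\Theta(t'-t)W_{ji}(t',t)\big),$$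 and let $C^{\pm}_{ij}$, $X^{\pm}_{ij}$ be obtained by replacing each $W_{kl}(s,s')$ by its symmetric part $W^+_{kl}(s,s')=\tfrac12\langle\{\phi[f_k](s),\phi[f_l](s')\}\rangle$, respectively its antisymmetric part $W^-_{kl}(s,s')=\tfrac12\langle[\phi[f_k](s),\phi[f_l](s')]\rangle$. All these integrals converge absolutely. In the pointlike limit $f_i\to\delta^{(3)}(\cdot-\mathbf x_i)$ (each $f_i\ge 0$ has integral $1$ and is supported in a ball around $\mathbf x_i$ whose radius tends to $0$) the matrix elements converge to the following values. For every $i$, $$P_i=\frac{\lambda^2}{8\pi^2\sigma^2}\Big(e^{-\Omega^2\sigma^2}-\sqrt\pi\,\Omega\sigma\,\mathrm{erfc}(\sigma\Omega)\Big),$$ and for all $i,j$ with $x:=|\mathbf x_i-\mathbf x_j|>0$, $$C^+_{ij}=\frac{\lambda^2}{8\pi^{3/2}x\sigma}e^{-(x/2\sigma)^2}\,\mathrm{Im}\Big[e^{i\Omega x}\,\mathrm{erf}\Big(i\frac{x}{2\sigma}+\Omega\sigma\Big)\Big],\qquad C^-_{ij}=-\frac{\lambda^2}{8\pi^{3/2}x\sigma}e^{-(x/2\sigma)^2}\sin(\Omega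 x),$$ $$X^+_{ij}=-\frac{\lambda^2}{4\pi^2x\sigma}e^{-\sigma^2\Omega^2}D\Big(\frac{x}{2\sigma}\Big),\qquad X^-_{ij}=\frac{i\lambda^2}{8\pi^{3/2}x\sigma}e^{-\sigma^2\Omega^2-(x/2\sigma)^2},$$ and $C_{ij}=C^+_{ij}+C^-_{ij}$, $X_{ij}=X^+_{ij}+X^-_{ij}$. Here $\mathrm{erf}(z)=\frac{2}{\sqrt\pi}\int_0^ze^{-w^2}dw$, $\mathrm{erfc}(z)=1-\mathrm{erf}(z)$ and $D(z)=e^{-z^2}\int_0^ze^{w^2}dw$. -/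

import Mathlib

open MeasureTheory Filter Topology
open scoped SchwartzMap

noncomputable section

namespace UDW

/-- Position space (and momentum space) of `3+1` Minkowski space; the time coordinate is a
separate real variable, and `ħ = c = 1`. -/
abbrev Space : Type := EuclideanSpace ℝ (Fin 3)

/-! ### Bosonic Fock space and the vacuum state -/

/-- One-particle space: square-integrable functions of the momentum. -/
abbrev OneParticle : Type := Lp ℂ 2 (volume : Measure Space)

/-- The (finite-particle) symmetric Fock space over the one-particle space. -/
abbrev Fock : Type := SymmetricAlgebra ℂ OneParticle

/-- The vacuum vector `|0⟩`. -/
def vacuum : Fock := 1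

/-- The creation operator `a†(u) = ∫ d³k u(k) a†_k`. -/
def creation (u : OneParticle) : Module.End ℂ Fock :=
  LinearMap.mulLeft ℂ (SymmetricAlgebra.ι ℂ OneParticle u)

/-- Auxiliary algebra morphism `ψ ↦ ψ + ε a(u)ψ` into the dual numbers over the Fock space,
determined by `v ↦ v + ε ⟨u, v⟩` on the one-particle space. -/
def annihilationHom (u : OneParticle) : Fock →ₐ[ℂ] TrivSqZeroExt Fock Fock :=
  SymmetricAlgebra.lift
    ((TrivSqZeroExt.inlAlgHom ℂ Fock Fock).toLinearMap ∘ₗ SymmetricAlgebra.ι ℂ OneParticle +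
      (TrivSqZeroExt.inrHom Fock Fock).restrictScalars ℂ ∘ₗ
        Algebra.linearMap ℂ Fock ∘ₗ innerₛₗ ℂ u)

/-- The annihilation operator `a(u) = ∫ d³k conj(u(k)) a_k`: the derivation of the symmetric
algebra with `a(u) v = ⟨u, v⟩ |0⟩` on one-particle vectors. -/
def annihilation (u : OneParticle) : Module.End ℂ Fock :=
  (TrivSqZeroExt.sndHom Fock Fock).restrictScalars ℂ ∘ₗ (annihilationHom u).toLinearMap

/-- Vacuum expectation value `Tr(|0⟩⟨0| A) = ⟨0| A |0⟩`: the zero-particle component of `A|0⟩`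
(different particle numbers are orthogonal). -/
def vacuumExpectation (A : Module.End ℂ Fock) : ℂ :=
  SymmetricAlgebra.algebraMapInv (A vacuum)

theorem annihilationHom_fst (u : OneParticle) (ψ : Fock) : (annihilationHom u ψ).fst = ψ := by
  have h : (TrivSqZeroExt.fstHom ℂ Fock Fock).comp (annihilationHom u) = AlgHom.id ℂ Fock := by
    apply SymmetricAlgebra.algHom_ext
    ext v
    simp [annihilationHom]
  exact DFunLike.congr_fun h ψ

/-- The annihilation operators kill the vacuum. -/
theorem annihilation_vacuum (u : OneParticle) : annihilation u vacuum = 0 := by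
  simp [annihilation, vacuum]

/-- The canonical commutation relations `[a(u), a†(v)] = ⟨u, v⟩`. -/
theorem commutation_relation (u v : OneParticle) :
    annihilation u * creation v - creation v * annihilation u = (inner ℂ u v : ℂ) • 1 := by
  apply LinearMap.ext
  intro ψ
  have h := annihilationHom_fst u ψ
  have h2 : annihilationHom u (SymmetricAlgebra.ι ℂ OneParticle v) =
      TrivSqZeroExt.inl (SymmetricAlgebra.ι ℂ OneParticle v) +
        TrivSqZeroExt.inr (algebraMap ℂ Fock (inner ℂ u v)) := by
    simp [annihilationHom]
  have h3 : annihilation u (SymmetricAlgebra.ι ℂ OneParticle v * ψ) =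
      SymmetricAlgebra.ι ℂ OneParticle v * annihilation u ψ +
        algebraMap ℂ Fock (inner ℂ u v) * ψ := by
    have h4 : ∀ φ, annihilation u φ = (annihilationHom u φ).snd := fun _ => rfl
    rw [h4, h4, map_mul, h2, TrivSqZeroExt.snd_mul, h, TrivSqZeroExt.fst_add,
      TrivSqZeroExt.snd_add, TrivSqZeroExt.fst_inl, TrivSqZeroExt.fst_inr, TrivSqZeroExt.snd_inl,
      TrivSqZeroExt.snd_inr, add_zero, zero_add, smul_eq_mul, op_smul_eq_smul, smul_eq_mul,
      mul_comm ψ]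
  rw [LinearMap.sub_apply, Module.End.mul_apply, Module.End.mul_apply, LinearMap.smul_apply,
    Module.End.one_apply, Algebra.smul_def]
  simp only [creation, LinearMap.mulLeft_apply]
  rw [h3, add_sub_cancel_left]

/-- `⟨0| a†(v) = 0`. -/
theorem vacuumExpectation_creation_mul (v : OneParticle) (A : Module.End ℂ Fock) :
    vacuumExpectation (creation v * A) = 0 := by
  simp [vacuumExpectation, creation, SymmetricAlgebra.algebraMapInv_ι]

theorem vacuumExpectation_one : vacuumExpectation 1 = 1 := by
  simp [vacuumExpectation, vacuum]

/-! ### The smeared massless scalar field -/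

/-- Fourier transform `f̃(k) = ∫ d³x f(x) e^{-i k·x}`. -/
def fourierProfile (f : 𝓢(Space, ℝ)) (k : Space) : ℂ :=
  ∫ x : Space, (f x : ℂ) * Complex.exp (-Complex.I * (inner ℝ k x : ℝ))

/-- The coefficient of `a†_k` in the smeared field `φ[f](t) = ∫ d³x f(x) φ(x,t)`, where
`φ(x,t) = ∫ d³k / √((2π)³ 2|k|) (a_k e^{-i|k|t + i k·x} + h.c.)`. -/
def modeFunction (f : 𝓢(Space, ℝ)) (t : ℝ) (k : Space) : ℂ :=
  Complex.exp (Complex.I * (‖k‖ * t : ℝ)) * fourierProfile f k /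
    (Real.sqrt ((2 * Real.pi) ^ 3 * (2 * ‖k‖)) : ℝ)

theorem fourierProfile_eq (f : 𝓢(Space, ℝ)) (k : Space) :
    fourierProfile f k =
      FourierTransform.fourier (f.postcompCLM Complex.ofRealCLM) ((2 * Real.pi)⁻¹ • k) := by
  rw [SchwartzMap.fourier_coe, Real.fourier_eq', fourierProfile]
  congr 1
  ext x
  rw [mul_comm, smul_eq_mul, SchwartzMap.postcompCLM_apply, real_inner_smul_right,
    real_inner_comm]
  congr 2
  have : Real.pi ≠ 0 := Real.pi_ne_zero
  push_cast
  field_simp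

theorem memLp_modeFunction (f : 𝓢(Space, ℝ)) (t : ℝ) :
    MemLp (modeFunction f t) 2 (volume : Measure Space) := by
  set g : 𝓢(Space, ℂ) := FourierTransform.fourier (f.postcompCLM Complex.ofRealCLM) with hg
  set a : ℝ := (2 * Real.pi)⁻¹ with ha
  have hf : fourierProfile f = fun k => g (a • k) := funext (fourierProfile_eq f)
  have ha0 : 0 < a := by positivity
  have ha1 : a ≤ 1 := inv_le_one_of_one_le₀ (by linarith [Real.pi_gt_three])
  obtain ⟨C, hC⟩ : ∃ C : ℝ, ∀ k : Space, (1 + ‖k‖) ^ 2 * ‖g k‖ ≤ C := by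
    refine ⟨2 ^ 2 * (Finset.Iic ((2, 0) : ℕ × ℕ)).sup
      (fun m => SchwartzMap.seminorm ℝ m.1 m.2) g, fun k => ?_⟩
    have h := SchwartzMap.one_add_le_sup_seminorm_apply (𝕜 := ℝ) (m := (2, 0)) (k := 2) (n := 0)
      le_rfl le_rfl g k
    rwa [norm_iteratedFDeriv_zero] at h
  have hmeas : AEStronglyMeasurable (modeFunction f t) (volume : Measure Space) := by
    have hc : Continuous (fourierProfile f) := by
      rw [hf]; exact g.continuous.comp (by fun_prop)
    have : Measurable (modeFunction f t) := by
      unfold modeFunction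
      have h1 := hc.measurable
      fun_prop
    exact this.aestronglyMeasurable
  rw [memLp_two_iff_integrable_sq_norm hmeas]
  have hint : Integrable (fun k : Space => (fun y : ℝ => y⁻¹ * ((1 + y) ^ 4)⁻¹) ‖k‖) := by
    rw [integrable_fun_norm_addHaar (volume : Measure Space)
      (f := fun y : ℝ => y⁻¹ * ((1 + y) ^ 4)⁻¹)]
    refine (integrable_inv_one_add_sq.integrableOn (s := Set.Ioi 0)).mono'
      (by fun_prop) ?_
    filter_upwards [ae_restrict_mem measurableSet_Ioi] with y hy
    have hy : 0 < y := hy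
    have hd : Module.finrank ℝ Space - 1 = 2 := by simp
    rw [hd, smul_eq_mul, Real.norm_of_nonneg (by positivity)]
    have : y ^ 2 * (y⁻¹ * ((1 + y) ^ 4)⁻¹) = y / (1 + y) ^ 4 := by field_simp
    rw [this, ← one_div, div_le_div_iff₀ (by positivity) (by positivity)]
    nlinarith [pow_pos hy 2, pow_pos hy 3, pow_pos hy 4]
  refine (hint.const_mul (((2 * Real.pi) ^ 3 * 2)⁻¹ * (C * (a ^ 2)⁻¹) ^ 2)).mono'
    (hmeas.norm.pow 2) ?_
  refine Eventually.of_forall fun k => ?_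
  have hn : ‖modeFunction f t k‖ ^ 2 = ‖g (a • k)‖ ^ 2 * (((2 * Real.pi) ^ 3 * 2)⁻¹ * ‖k‖⁻¹) := by
    rw [modeFunction, norm_div, norm_mul, mul_comm Complex.I, Complex.norm_exp_ofReal_mul_I, one_mul,
      hf, div_pow, Complex.norm_real, Real.norm_of_nonneg (Real.sqrt_nonneg _),
      Real.sq_sqrt (by positivity), div_eq_mul_inv, ← mul_assoc, mul_inv]
  have hb : ‖g (a • k)‖ ≤ C * (a ^ 2)⁻¹ * ((1 + ‖k‖) ^ 2)⁻¹ := by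
    have h1 := hC (a • k)
    rw [norm_smul, Real.norm_of_nonneg ha0.le] at h1
    rw [← div_eq_mul_inv, ← div_eq_mul_inv, div_div, le_div_iff₀ (by positivity)]
    refine le_trans ?_ h1
    rw [mul_comm]
    gcongr
    rw [← mul_pow]
    have : 0 ≤ ‖k‖ := norm_nonneg k
    gcongr
    linarith
  rw [Real.norm_of_nonneg (by positivity), hn]
  calc ‖g (a • k)‖ ^ 2 * (((2 * Real.pi) ^ 3 * 2)⁻¹ * ‖k‖⁻¹)
      ≤ (C * (a ^ 2)⁻¹ * ((1 + ‖k‖) ^ 2)⁻¹) ^ 2 * (((2 * Real.pi) ^ 3 * 2)⁻¹ * ‖k‖⁻¹) := by gcongr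
    _ = _ := by
      rw [mul_pow, inv_pow ((1 + ‖k‖) ^ 2), ← pow_mul]
      ring

/-- The spatially smeared field operator `φ[f](t)` at time `t`. -/
def smearedField (f : 𝓢(Space, ℝ)) (t : ℝ) : Module.End ℂ Fock :=
  annihilation ((memLp_modeFunction f t).toLp _) + creation ((memLp_modeFunction f t).toLp _)

/-! ### Detectors and matrix elements -/

/-- An Unruh-DeWitt detector: energy gap `Ω`, switching function `χ`, spatial smearing `f`. -/
structure Detector where
  gap : ℝ
  switching : ℝ → ℝ
  smearing : 𝓢(Space, ℝ)

/-- The Wightman function smeared by the two detectors,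
`⟨φ[f_A](t) φ[f_B](t')⟩ = ∫ d³x d³x' f_A(x) f_B(x') W((t,x),(t',x'))`. -/
def wightman (A B : Detector) (t t' : ℝ) : ℂ :=
  vacuumExpectation (smearedField A.smearing t * smearedField B.smearing t')

/-- Symmetric part `½⟨{φ[f_A](t), φ[f_B](t')}⟩`. -/
def wightmanSymm (A B : Detector) (t t' : ℝ) : ℂ :=
  (1 / 2) * vacuumExpectation (smearedField A.smearing t * smearedField B.smearing t' +
    smearedField B.smearing t' * smearedField A.smearing t)

/-- Antisymmetric part `½⟨[φ[f_A](t), φ[f_B](t')]⟩`. -/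
def wightmanAnti (A B : Detector) (t t' : ℝ) : ℂ :=
  (1 / 2) * vacuumExpectation (smearedField A.smearing t * smearedField B.smearing t' -
    smearedField B.smearing t' * smearedField A.smearing t)

/-- Heaviside step function, with `Θ(0) = 1/2` so that `Θ(t) + Θ(-t) = 1` for all `t`. -/
def heaviside (t : ℝ) : ℂ := if 0 < t then 1 else if t = 0 then 1 / 2 else 0

/-- The integrand `χ_A(t) χ_B(t') e^{-i(Ω_A t - Ω_B t')} K_{AB}(t,t')`; here `K` is the smeared
Wightman function or one of its two parts. -/
def integrandC (K : Detector → Detector → ℝ → ℝ → ℂ) (A B : Detector) (p : ℝ × ℝ) : ℂ :=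
  A.switching p.1 * B.switching p.2 *
    Complex.exp (-Complex.I * (A.gap * p.1 - B.gap * p.2 : ℝ)) * K A B p.1 p.2

/-- The integrand
`χ_A(t) χ_B(t') e^{i(Ω_A t + Ω_B t')} (Θ(t-t') K_{AB}(t,t') + Θ(t'-t) K_{BA}(t',t))`. -/
def integrandX (K : Detector → Detector → ℝ → ℝ → ℂ) (A B : Detector) (p : ℝ × ℝ) : ℂ :=
  A.switching p.1 * B.switching p.2 *
    Complex.exp (Complex.I * (A.gap * p.1 + B.gap * p.2 : ℝ)) *
      (heaviside (p.1 - p.2) * K A B p.1 p.2 + heaviside (p.2 - p.1) * K B A p.2 p.1)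

/-- Excitation probability `P` of a detector. -/
def matrixP (lam : ℝ) (A : Detector) : ℂ := lam ^ 2 * ∫ p : ℝ × ℝ, integrandC wightman A A p

def matrixC (lam : ℝ) (A B : Detector) : ℂ := lam ^ 2 * ∫ p : ℝ × ℝ, integrandC wightman A B p

def matrixCplus (lam : ℝ) (A B : Detector) : ℂ :=
  lam ^ 2 * ∫ p : ℝ × ℝ, integrandC wightmanSymm A B p

def matrixCminus (lam : ℝ) (A B : Detector) : ℂ :=
  lam ^ 2 * ∫ p : ℝ × ℝ, integrandC wightmanAnti A B p

def matrixX (lam : ℝ) (A B : Detector) : ℂ :=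
  -lam ^ 2 * ∫ p : ℝ × ℝ, integrandX wightman A B p

def matrixXplus (lam : ℝ) (A B : Detector) : ℂ :=
  -lam ^ 2 * ∫ p : ℝ × ℝ, integrandX wightmanSymm A B p

def matrixXminus (lam : ℝ) (A B : Detector) : ℂ :=
  -lam ^ 2 * ∫ p : ℝ × ℝ, integrandX wightmanAnti A B p

/-! ### Gaussian switching and the pointlike limit -/

/-- `χ(t) = e^{-t²/(2σ²)} / √(2πσ²)`. -/
def gaussianSwitching (σ : ℝ) (t : ℝ) : ℝ :=
  1 / Real.sqrt (2 * Real.pi * σ ^ 2) * Real.exp (-t ^ 2 / (2 * σ ^ 2))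

/-- The filter `f → δ(· - x₀)` of smearing functions: nonnegative, of total mass one, and supported
in arbitrarily small balls around `x₀`. -/
def deltaFilter (x₀ : Space) : Filter 𝓢(Space, ℝ) :=
  ⨅ r : Set.Ioi (0 : ℝ), 𝓟 {f | (∀ x, 0 ≤ f x) ∧ ∫ x, f x = 1 ∧
    Function.support f ⊆ Metric.ball x₀ r}

instance deltaFilter_neBot (x₀ : Space) : (deltaFilter x₀).NeBot := by
  have : Nonempty (Set.Ioi (0 : ℝ)) := ⟨⟨1, Set.mem_Ioi.2 one_pos⟩⟩
  refine iInf_neBot_of_directed' ?_ fun r => principal_neBot_iff.2 ?_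
  · intro r s
    refine ⟨⟨min r s, Set.mem_Ioi.2 (lt_min r.2 s.2)⟩, ?_, ?_⟩
    · exact principal_mono.2 fun f hf =>
        ⟨hf.1, hf.2.1, hf.2.2.trans (Metric.ball_subset_ball (min_le_left _ _))⟩
    · exact principal_mono.2 fun f hf =>
        ⟨hf.1, hf.2.1, hf.2.2.trans (Metric.ball_subset_ball (min_le_right _ _))⟩
  · have hr : (0 : ℝ) < r := r.2
    let b : ContDiffBump x₀ := ⟨r / 2, r, by positivity, by linarith⟩
    refine ⟨(b.hasCompactSupport_normed (μ := volume)).toSchwartzMap b.contDiff_normed,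
      fun x => b.nonneg_normed x, b.integral_normed, ?_⟩
    exact (b.support_normed_eq (μ := volume)).subset

/-- Pointlike limit of a family of detectors at the positions `pos i`: each smearing function `f i`
tends to `δ(· - pos i)`. -/
def pointlike {N : ℕ} (pos : Fin N → Space) : Filter (Fin N → 𝓢(Space, ℝ)) :=
  Filter.pi fun i => deltaFilter (pos i)

/-- The detector with gap `Ω`, Gaussian switching of width `σ`, and smearing function `f`. -/
def gaussianDetector (Ω σ : ℝ) (f : 𝓢(Space, ℝ)) : Detector where
  gap := Ω
  switching := gaussianSwitching σ
  smearing := f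

/-! ### Special functions -/

/-- `erf z = (2/√π) ∫_0^z e^{-w²} dw`, the integral being taken along the segment from `0` to
`z`. -/
def erf (z : ℂ) : ℂ :=
  2 / Real.sqrt Real.pi * ∫ s in (0 : ℝ)..1, z * Complex.exp (-(s * z) ^ 2)

def erfc (z : ℂ) : ℂ := 1 - erf z

/-- Dawson function `D(z) = e^{-z²} ∫_0^z e^{w²} dw`, the integral being taken along the segment
from `0` to `z`. -/
def dawson (z : ℂ) : ℂ :=
  Complex.exp (-z ^ 2) * ∫ s in (0 : ℝ)..1, z * Complex.exp ((s * z) ^ 2)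

/-! ### The closed forms -/

def closedP (lam Ω σ : ℝ) : ℂ :=
  lam ^ 2 / (8 * Real.pi ^ 2 * σ ^ 2) *
    (Complex.exp (-Ω ^ 2 * σ ^ 2) - Real.sqrt Real.pi * Ω * σ * erfc (σ * Ω))

def closedCplus (lam Ω σ x : ℝ) : ℂ :=
  lam ^ 2 / (8 * (Real.pi ^ (3 / 2 : ℝ) : ℝ) * x * σ) * Complex.exp (-(x / (2 * σ)) ^ 2) *
    (Complex.exp (Complex.I * Ω * x) * erf (Complex.I * (x / (2 * σ)) + Ω * σ)).im

def closedCminus (lam Ω σ x : ℝ) : ℂ :=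
  -(lam ^ 2 / (8 * (Real.pi ^ (3 / 2 : ℝ) : ℝ) * x * σ)) * Complex.exp (-(x / (2 * σ)) ^ 2) *
    Complex.sin (Ω * x)

def closedXplus (lam Ω σ x : ℝ) : ℂ :=
  -(lam ^ 2 / (4 * Real.pi ^ 2 * x * σ)) * Complex.exp (-σ ^ 2 * Ω ^ 2) * dawson (x / (2 * σ))

def closedXminus (lam Ω σ x : ℝ) : ℂ :=
  Complex.I * lam ^ 2 / (8 * (Real.pi ^ (3 / 2 : ℝ) : ℝ) * x * σ) *
    Complex.exp (-σ ^ 2 * Ω ^ 2 - (x / (2 * σ)) ^ 2)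

end UDW

end

namespace UDW

open ComplexConjugate

/-! ### The two-point function in momentum space -/

/-! The canonical commutation relations turn the smeared two-point function into an inner product of
mode functions, that is, a superposition of phases `e^{-i|k|(t-t')}` against the integrable weight
`spectralWeight`. Reversing the operator order is undone by `k ↦ -k` at the price of the opposite
frequency, so the symmetric and antisymmetric parts carry `cos` and `-i sin` against the same
weight. The Heaviside combination in `X` becomes a function of `|t - t'|`. `IsModeSum` captures all
these kernels at once. The phases are bounded by 1 and the switchings are integrable, so Fubini
gives absolute convergence and lets the time integrals be done first
(`IsModeSum.integral_integrandC`, `IsModeSum.integral_integrandX`).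

For `P`, `C^±` and `X^+` the time integrals are Gaussians in `|k|`. Since `|f̃| ≤ 1` and `f̃(k) →
e^{-ik·x₀}`, dominated convergence gives the pointlike limit
(`tendsto_integral_mul_spectralWeight`). Spherical coordinates reduce it to a sine transform on the
half line (`integral_cexp_inner_mul_radial`), or to a first moment at coincident points. Completing
the square and using an entire primitive of `e^{-z²}` evaluates both (`integral_Ioi_cexp_neg_sq`).

For `X^-` this domination fails: the time integral of `sin(|k||t-t'|)` decays only like `1/|k|`, so
the momentum integrand is not absolutely integrable once `|f̃|` is replaced by 1. That amplitude is
instead recognised as a constant times `|k|` times the Fourier transform of `|k|`-independent data: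
the kernel `u(y) = h(|y|)/|y|`, with `h` the Gaussian distribution of `t - t'`; this reflects that
the massless commutator lives on the light cone. Returning to position space
(`integral_fourierKernel_mul_conj_mul`) leaves `u(x - y)` averaged over `f` and `g`, whose limit is
the value of `u` at the separation, where it is continuous. -/

/-- Moving annihilators to the right and creators to the left leaves only the commutator term of
`annihilation u * creation v`. -/
theorem vacuumExpectation_field_mul (u v : OneParticle) :
    vacuumExpectation ((annihilation u + creation u) * (annihilation v + creation v)) =
      inner ℂ u v := by
  have h1 : vacuumExpectation ((annihilation u + creation u) * (annihilation v + creation v)) =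
      vacuumExpectation (annihilation u * creation v) +
        vacuumExpectation (creation u * (annihilation v + creation v)) := by
    simp [vacuumExpectation, add_mul, annihilation_vacuum]
  have h2 : annihilation u * creation v =
      (inner ℂ u v : ℂ) • 1 + creation v * annihilation u := by
    rw [← commutation_relation]; abel
  have h3 : vacuumExpectation ((inner ℂ u v : ℂ) • 1 + creation v * annihilation u) =
      (inner ℂ u v : ℂ) * vacuumExpectation 1 +
        vacuumExpectation (creation v * annihilation u) := by
    simp [vacuumExpectation]
  rw [h1, vacuumExpectation_creation_mul, h2, h3, vacuumExpectation_creation_mul,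
    vacuumExpectation_one, add_zero, add_zero, mul_one]

/-- The momentum-space density of the two-point function smeared with `f` and `g`. -/
noncomputable def spectralWeight (f g : 𝓢(Space, ℝ)) (k : Space) : ℂ :=
  conj (fourierProfile f k) * fourierProfile g k / ((2 * Real.pi) ^ 3 * (2 * ‖k‖) : ℝ)

theorem conj_modeFunction_mul (f g : 𝓢(Space, ℝ)) (t t' : ℝ) (k : Space) :
    conj (modeFunction f t k) * modeFunction g t' k =
      Complex.exp (-Complex.I * (‖k‖ * (t - t') : ℝ)) * spectralWeight f g k := by
  have h0 : (0 : ℝ) ≤ (2 * Real.pi) ^ 3 * (2 * ‖k‖) := by positivity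
  have hs : ((Real.sqrt ((2 * Real.pi) ^ 3 * (2 * ‖k‖)) : ℝ) : ℂ) *
      (Real.sqrt ((2 * Real.pi) ^ 3 * (2 * ‖k‖)) : ℝ) = ((2 * Real.pi) ^ 3 * (2 * ‖k‖) : ℝ) := by
    rw [← Complex.ofReal_mul, Real.mul_self_sqrt h0]
  have he : Complex.exp (-Complex.I * (‖k‖ * (t - t') : ℝ)) =
      Complex.exp (-Complex.I * (‖k‖ * t : ℝ)) * Complex.exp (Complex.I * (‖k‖ * t' : ℝ)) := by
    rw [← Complex.exp_add]; push_cast; ring_nf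
  rw [spectralWeight, modeFunction, modeFunction, map_div₀, map_mul, ← Complex.exp_conj, map_mul,
    Complex.conj_I, Complex.conj_ofReal, Complex.conj_ofReal, div_mul_div_comm, hs, he]
  ring

/-- At equal times zero the phase is 1, so the weight is a product of two square-integrable mode
functions; this handles both the `1/|k|` singularity and the decay. -/
theorem integrable_spectralWeight (f g : 𝓢(Space, ℝ)) : Integrable (spectralWeight f g) := by
  have h := (memLp_modeFunction f 0).star.integrable_mul (memLp_modeFunction g 0)
  refine h.congr (Eventually.of_forall fun k => ?_)
  have := conj_modeFunction_mul f g 0 0 k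
  simpa using this

theorem inner_modeFunction (f g : 𝓢(Space, ℝ)) (t t' : ℝ) :
    inner ℂ ((memLp_modeFunction f t).toLp _ : OneParticle) ((memLp_modeFunction g t').toLp _) =
      ∫ k, Complex.exp (-Complex.I * (‖k‖ * (t - t') : ℝ)) * spectralWeight f g k := by
  rw [L2.inner_def]
  refine integral_congr_ae ?_
  filter_upwards [(memLp_modeFunction f t).coeFn_toLp, (memLp_modeFunction g t').coeFn_toLp]
    with k h1 h2
  rw [h1, h2, RCLike.inner_apply, mul_comm]
  exact conj_modeFunction_mul f g t t' k

theorem fourierProfile_neg (f : 𝓢(Space, ℝ)) (k : Space) :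
    fourierProfile f (-k) = conj (fourierProfile f k) := by
  rw [fourierProfile, fourierProfile, ← integral_conj]
  refine integral_congr_ae (Eventually.of_forall fun x => ?_)
  simp [← Complex.exp_conj]

theorem spectralWeight_neg (f g : 𝓢(Space, ℝ)) (k : Space) :
    spectralWeight f g (-k) = spectralWeight g f k := by
  simp only [spectralWeight, fourierProfile_neg, norm_neg, Complex.conj_conj]
  ring

theorem vacuumExpectation_smearedField (f g : 𝓢(Space, ℝ)) (t t' : ℝ) :
    vacuumExpectation (smearedField f t * smearedField g t') =
      ∫ k, Complex.exp (-Complex.I * (‖k‖ * (t - t') : ℝ)) * spectralWeight f g k := by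
  rw [smearedField, smearedField, vacuumExpectation_field_mul, inner_modeFunction]

/-- The substitution `k ↦ -k` exchanges the two profiles in the weight, because the smearings are
real. Both operator orders thus share one weight and differ only in the sign of the frequency. -/
theorem vacuumExpectation_smearedField_swap (f g : 𝓢(Space, ℝ)) (t t' : ℝ) :
    vacuumExpectation (smearedField g t' * smearedField f t) =
      ∫ k, Complex.exp (Complex.I * (‖k‖ * (t - t') : ℝ)) * spectralWeight f g k := by
  rw [vacuumExpectation_smearedField, ← integral_neg_eq_self]
  refine integral_congr_ae (Eventually.of_forall fun k => ?_)
  simp only [spectralWeight_neg, norm_neg]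
  congr 2
  push_cast
  ring

theorem integrable_mul_spectralWeight (f g : 𝓢(Space, ℝ)) {q : Space → ℂ} (hq : Continuous q)
    (hb : ∀ k, ‖q k‖ ≤ 1) : Integrable fun k => q k * spectralWeight f g k :=
  (integrable_spectralWeight f g).bdd_mul (c := 1) hq.aestronglyMeasurable
    (Eventually.of_forall hb)

theorem integrable_phase_mul_spectralWeight (f g : 𝓢(Space, ℝ)) (s : ℝ) :
    Integrable fun k => Complex.exp (Complex.I * (‖k‖ * s : ℝ)) * spectralWeight f g k := by
  refine integrable_mul_spectralWeight f g (by fun_prop) fun k => ?_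
  rw [mul_comm, Complex.norm_exp_ofReal_mul_I]

theorem integrable_neg_phase_mul_spectralWeight (f g : 𝓢(Space, ℝ)) (s : ℝ) :
    Integrable fun k => Complex.exp (-Complex.I * (‖k‖ * s : ℝ)) * spectralWeight f g k := by
  refine (integrable_phase_mul_spectralWeight f g (-s)).congr (Eventually.of_forall fun k => ?_)
  simp

theorem wightman_eq (A B : Detector) (t t' : ℝ) :
    wightman A B t t' = ∫ k, Complex.exp (-Complex.I * (‖k‖ * (t - t') : ℝ)) *
      spectralWeight A.smearing B.smearing k :=
  vacuumExpectation_smearedField _ _ _ _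

theorem wightman_swap (A B : Detector) (t t' : ℝ) :
    wightman B A t' t = ∫ k, Complex.exp (Complex.I * (‖k‖ * (t - t') : ℝ)) *
      spectralWeight A.smearing B.smearing k :=
  vacuumExpectation_smearedField_swap _ _ _ _

theorem vacuumExpectation_add (S T : Module.End ℂ Fock) :
    vacuumExpectation (S + T) = vacuumExpectation S + vacuumExpectation T := by
  simp [vacuumExpectation]

theorem vacuumExpectation_sub (S T : Module.End ℂ Fock) :
    vacuumExpectation (S - T) = vacuumExpectation S - vacuumExpectation T := by
  simp [vacuumExpectation]

theorem wightmanSymm_eq_half_add (A B : Detector) (t t' : ℝ) :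
    wightmanSymm A B t t' = (1 / 2) * (wightman A B t t' + wightman B A t' t) := by
  rw [wightmanSymm, vacuumExpectation_add, wightman, wightman]

theorem wightmanAnti_eq_half_sub (A B : Detector) (t t' : ℝ) :
    wightmanAnti A B t t' = (1 / 2) * (wightman A B t t' - wightman B A t' t) := by
  rw [wightmanAnti, vacuumExpectation_sub, wightman, wightman]

theorem wightmanSymm_add_wightmanAnti (A B : Detector) (t t' : ℝ) :
    wightmanSymm A B t t' + wightmanAnti A B t t' = wightman A B t t' := by
  rw [wightmanSymm_eq_half_add, wightmanAnti_eq_half_sub]; ring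

theorem wightmanSymm_eq (A B : Detector) (t t' : ℝ) :
    wightmanSymm A B t t' = ∫ k, Complex.cos (‖k‖ * (t - t') : ℝ) *
      spectralWeight A.smearing B.smearing k := by
  rw [wightmanSymm_eq_half_add, wightman_eq, wightman_swap, ← integral_add
    (integrable_neg_phase_mul_spectralWeight _ _ _) (integrable_phase_mul_spectralWeight _ _ _),
    ← integral_const_mul]
  refine integral_congr_ae (Eventually.of_forall fun k => ?_)
  simp only [Complex.cos]
  ring_nf

theorem wightmanAnti_eq (A B : Detector) (t t' : ℝ) :
    wightmanAnti A B t t' = ∫ k, (-Complex.I * Complex.sin (‖k‖ * (t - t') : ℝ)) *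
      spectralWeight A.smearing B.smearing k := by
  rw [wightmanAnti_eq_half_sub, wightman_eq, wightman_swap, ← integral_sub
    (integrable_neg_phase_mul_spectralWeight _ _ _) (integrable_phase_mul_spectralWeight _ _ _),
    ← integral_const_mul]
  refine integral_congr_ae (Eventually.of_forall fun k => ?_)
  simp only [Complex.sin]
  ring_nf
  rw [Complex.I_sq]
  ring

/-! ### Integrands as superpositions of modes -/

section Superposition

variable {ψ : ℝ × ℝ → ℂ} {Q : ℝ × ℝ → ℝ → ℂ} {w : Space → ℂ}

/-- The mode factor is bounded, so joint integrability comes from the tensor product of `ψ` and `w`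
alone. This is the hypothesis of Fubini for every matrix element. -/
theorem integrable_superposition_prod (hψ : Integrable ψ) (hQ : Continuous (Function.uncurry Q))
    (hb : ∀ p κ, ‖Q p κ‖ ≤ 1) (hw : Integrable w) :
    Integrable (fun z : (ℝ × ℝ) × Space => Q z.1 ‖z.2‖ * (ψ z.1 * w z.2)) := by
  refine (hψ.mul_prod hw).bdd_mul (c := 1) ?_ (Eventually.of_forall fun z => hb _ _)
  exact (hQ.comp (continuous_fst.prodMk continuous_snd.norm)).aestronglyMeasurable

theorem integrable_superposition (hψ : Integrable ψ) (hQ : Continuous (Function.uncurry Q))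
    (hb : ∀ p κ, ‖Q p κ‖ ≤ 1) (hw : Integrable w) :
    Integrable fun p => ψ p * ∫ k, Q p ‖k‖ * w k := by
  refine (integrable_superposition_prod hψ hQ hb hw).integral_prod_left.congr
    (Eventually.of_forall fun p => ?_)
  simp only
  rw [← integral_const_mul]
  congr 1 with k
  ring

theorem integral_superposition (hψ : Integrable ψ) (hQ : Continuous (Function.uncurry Q))
    (hb : ∀ p κ, ‖Q p κ‖ ≤ 1) (hw : Integrable w) :
    ∫ p, ψ p * ∫ k, Q p ‖k‖ * w k = ∫ k, (∫ p, ψ p * Q p ‖k‖) * w k := by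
  calc ∫ p, ψ p * ∫ k, Q p ‖k‖ * w k = ∫ p, ∫ k, Q p ‖k‖ * (ψ p * w k) := by
        congr 1 with p
        rw [← integral_const_mul]
        congr 1 with k
        ring
    _ = ∫ k, ∫ p, Q p ‖k‖ * (ψ p * w k) :=
        integral_integral_swap (integrable_superposition_prod hψ hQ hb hw)
    _ = _ := by
        congr 1 with k
        rw [← integral_mul_const]
        congr 1 with p
        ring

end Superposition

/-! ### Gaussian switching: integrability and time integrals -/

theorem integral_cexp_neg_mul_sq_add {a : ℝ} (ha : 0 < a) (c d : ℂ) :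
    ∫ x : ℝ, Complex.exp (-a * x ^ 2 + c * x + d) =
      Real.sqrt (Real.pi / a) * Complex.exp (d + c ^ 2 / (4 * a)) := by
  rw [integral_cexp_quadratic (by simpa using ha)]
  congr 1
  · rw [Real.sqrt_eq_rpow, Complex.ofReal_cpow (by positivity)]
    push_cast
    simp
  · congr 1
    have : (a : ℂ) ≠ 0 := by exact_mod_cast ha.ne'
    field_simp
    ring

theorem integrable_gaussianSwitching {σ : ℝ} (hσ : 0 < σ) : Integrable (gaussianSwitching σ) := by
  have h := (integrable_exp_neg_mul_sq (b := 1 / (2 * σ ^ 2)) (by positivity)).const_mul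
    (1 / Real.sqrt (2 * Real.pi * σ ^ 2))
  refine h.congr (Eventually.of_forall fun t => ?_)
  simp only [gaussianSwitching]
  congr 2
  ring

theorem integral_gaussianSwitching_mul_cexp {σ : ℝ} (hσ : 0 < σ) (a : ℝ) :
    ∫ t : ℝ, (gaussianSwitching σ t : ℂ) * Complex.exp (Complex.I * (a * t : ℝ)) =
      Complex.exp (-(σ ^ 2 * a ^ 2 / 2 : ℝ)) := by
  have hpi := Real.pi_pos
  have h := integral_cexp_neg_mul_sq_add (a := 1 / (2 * σ ^ 2)) (by positivity) (Complex.I * a) 0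
  have hσ' : (σ : ℂ) ≠ 0 := by exact_mod_cast hσ.ne'
  have h2 : ∀ t : ℝ, (gaussianSwitching σ t : ℂ) * Complex.exp (Complex.I * (a * t : ℝ)) =
      (1 / Real.sqrt (2 * Real.pi * σ ^ 2) : ℝ) * Complex.exp
        (-((1 / (2 * σ ^ 2) : ℝ) : ℂ) * (t : ℂ) ^ 2 + Complex.I * a * t + 0) := by
    intro t
    rw [gaussianSwitching, Complex.ofReal_mul, mul_assoc, Complex.ofReal_exp, ← Complex.exp_add]
    congr 2
    push_cast
    field_simp
    ring
  simp_rw [h2]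
  rw [integral_const_mul, h]
  have h3 : Real.pi / (1 / (2 * σ ^ 2)) = 2 * Real.pi * σ ^ 2 := by field_simp
  rw [h3, ← mul_assoc, ← Complex.ofReal_mul, one_div_mul_cancel (by positivity),
    Complex.ofReal_one, one_mul]
  congr 1
  push_cast
  field_simp
  rw [Complex.I_sq]
  ring

/-- The switching and phase factors in `integrandC` for two equal Gaussian switchings. -/
noncomputable def switchC (Ω σ : ℝ) (p : ℝ × ℝ) : ℂ :=
  gaussianSwitching σ p.1 * gaussianSwitching σ p.2 *
    Complex.exp (-Complex.I * (Ω * p.1 - Ω * p.2 : ℝ))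

/-- The switching and phase factors in `integrandX` for two equal Gaussian switchings. -/
noncomputable def switchX (Ω σ : ℝ) (p : ℝ × ℝ) : ℂ :=
  gaussianSwitching σ p.1 * gaussianSwitching σ p.2 *
    Complex.exp (Complex.I * (Ω * p.1 + Ω * p.2 : ℝ))

theorem integrable_switching_prod {σ : ℝ} (hσ : 0 < σ) {φ : ℝ × ℝ → ℝ} (hφ : Continuous φ) :
    Integrable fun p : ℝ × ℝ => (gaussianSwitching σ p.1 : ℂ) * gaussianSwitching σ p.2 *
      Complex.exp (Complex.I * φ p) := by
  have h := (integrable_gaussianSwitching hσ).ofReal (𝕜 := ℂ)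
  refine (h.mul_prod h).mul_bdd (c := 1) ?_ (Eventually.of_forall fun p => ?_)
  · exact Continuous.aestronglyMeasurable (by fun_prop)
  · rw [mul_comm, Complex.norm_exp_ofReal_mul_I]

theorem integrable_switchC (Ω : ℝ) {σ : ℝ} (hσ : 0 < σ) : Integrable (switchC Ω σ) := by
  refine (integrable_switching_prod hσ (φ := fun p => -(Ω * p.1 - Ω * p.2))
    (by fun_prop)).congr (Eventually.of_forall fun p => ?_)
  simp only [switchC, Complex.ofReal_neg, mul_neg, neg_mul]

theorem integrable_switchX (Ω : ℝ) {σ : ℝ} (hσ : 0 < σ) : Integrable (switchX Ω σ) :=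
  integrable_switching_prod hσ (φ := fun p => Ω * p.1 + Ω * p.2) (by fun_prop)

theorem integral_switching_prod {σ : ℝ} (hσ : 0 < σ) (a b : ℝ) :
    ∫ p : ℝ × ℝ, (gaussianSwitching σ p.1 : ℂ) * gaussianSwitching σ p.2 *
      Complex.exp (Complex.I * (a * p.1 + b * p.2 : ℝ)) =
      Complex.exp (-(σ ^ 2 * (a ^ 2 + b ^ 2) / 2 : ℝ)) := by
  have h := integral_prod_mul (μ := (volume : Measure ℝ)) (ν := (volume : Measure ℝ))
    (fun t : ℝ => (gaussianSwitching σ t : ℂ) * Complex.exp (Complex.I * (a * t : ℝ)))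
    (fun t : ℝ => (gaussianSwitching σ t : ℂ) * Complex.exp (Complex.I * (b * t : ℝ)))
  rw [integral_gaussianSwitching_mul_cexp hσ, integral_gaussianSwitching_mul_cexp hσ,
    ← Complex.exp_add] at h
  rw [Measure.volume_eq_prod]
  convert h using 1
  · congr 1 with p
    rw [Complex.ofReal_add, mul_add, Complex.exp_add]
    ring
  · congr 1
    push_cast
    ring

/-- The detector and mode phases combine to opposite frequencies `∓(Ω + κ)` at the two times. -/
theorem integral_switchC_mul_phase (Ω : ℝ) {σ : ℝ} (hσ : 0 < σ) (κ : ℝ) :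
    ∫ p : ℝ × ℝ, switchC Ω σ p * Complex.exp (-Complex.I * (κ * (p.1 - p.2) : ℝ)) =
      Complex.exp (-(σ ^ 2 * (Ω + κ) ^ 2 : ℝ)) := by
  have h := integral_switching_prod hσ (-(Ω + κ)) (Ω + κ)
  convert h using 1
  · congr 1 with p
    rw [switchC, mul_assoc, ← Complex.exp_add]
    congr 2
    push_cast
    ring
  · congr 1
    push_cast
    ring

/-- Here the frequencies are `Ω - κ` and `Ω + κ`; their squares add up to `2(Ω² + κ²)`, so the cross
term disappears. -/
theorem integral_switchX_mul_phase (Ω : ℝ) {σ : ℝ} (hσ : 0 < σ) (κ : ℝ) :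
    ∫ p : ℝ × ℝ, switchX Ω σ p * Complex.exp (-Complex.I * (κ * (p.1 - p.2) : ℝ)) =
      Complex.exp (-(σ ^ 2 * (Ω ^ 2 + κ ^ 2) : ℝ)) := by
  have h := integral_switching_prod hσ (Ω - κ) (Ω + κ)
  convert h using 1
  · congr 1 with p
    rw [switchX, mul_assoc, ← Complex.exp_add]
    congr 2
    push_cast
    ring
  · congr 1
    push_cast
    ring

theorem integrable_mul_phase {ψ : ℝ × ℝ → ℂ} (hψ : Integrable ψ) (κ : ℝ) :
    Integrable fun p => ψ p * Complex.exp (-Complex.I * (κ * (p.1 - p.2) : ℝ)) := by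
  refine hψ.mul_bdd (c := 1) (Continuous.aestronglyMeasurable (by fun_prop))
    (Eventually.of_forall fun p => ?_)
  rw [show -Complex.I * (κ * (p.1 - p.2) : ℝ) = (-(κ * (p.1 - p.2)) : ℝ) * Complex.I by
    push_cast; ring, Complex.norm_exp_ofReal_mul_I]

theorem integral_mul_cos {ψ : ℝ × ℝ → ℂ} (hψ : Integrable ψ) (κ : ℝ) :
    ∫ p, ψ p * Complex.cos (κ * (p.1 - p.2) : ℝ) =
      (1 / 2) * ((∫ p, ψ p * Complex.exp (-Complex.I * (κ * (p.1 - p.2) : ℝ))) +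
        ∫ p, ψ p * Complex.exp (-Complex.I * (-κ * (p.1 - p.2) : ℝ))) := by
  rw [← integral_add (integrable_mul_phase hψ _) (integrable_mul_phase hψ _), ← integral_const_mul]
  congr 1 with p
  rw [Complex.cos]
  push_cast
  ring_nf

theorem integral_mul_sin {ψ : ℝ × ℝ → ℂ} (hψ : Integrable ψ) (κ : ℝ) :
    ∫ p, ψ p * (-Complex.I * Complex.sin (κ * (p.1 - p.2) : ℝ)) =
      (1 / 2) * ((∫ p, ψ p * Complex.exp (-Complex.I * (κ * (p.1 - p.2) : ℝ))) -
        ∫ p, ψ p * Complex.exp (-Complex.I * (-κ * (p.1 - p.2) : ℝ))) := by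
  rw [← integral_sub (integrable_mul_phase hψ _) (integrable_mul_phase hψ _), ← integral_const_mul]
  congr 1 with p
  rw [Complex.sin]
  push_cast
  ring_nf
  rw [Complex.I_sq]
  ring

theorem integral_switchC_mul_cos (Ω : ℝ) {σ : ℝ} (hσ : 0 < σ) (κ : ℝ) :
    ∫ p : ℝ × ℝ, switchC Ω σ p * Complex.cos (κ * (p.1 - p.2) : ℝ) =
      (1 / 2) * (Complex.exp (-(σ ^ 2 * (Ω + κ) ^ 2 : ℝ)) +
        Complex.exp (-(σ ^ 2 * (Ω - κ) ^ 2 : ℝ))) := by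
  rw [integral_mul_cos (integrable_switchC Ω hσ), integral_switchC_mul_phase Ω hσ,
    integral_switchC_mul_phase Ω hσ, sub_eq_add_neg]

theorem integral_switchC_mul_sin (Ω : ℝ) {σ : ℝ} (hσ : 0 < σ) (κ : ℝ) :
    ∫ p : ℝ × ℝ, switchC Ω σ p * (-Complex.I * Complex.sin (κ * (p.1 - p.2) : ℝ)) =
      (1 / 2) * (Complex.exp (-(σ ^ 2 * (Ω + κ) ^ 2 : ℝ)) -
        Complex.exp (-(σ ^ 2 * (Ω - κ) ^ 2 : ℝ))) := by
  rw [integral_mul_sin (integrable_switchC Ω hσ), integral_switchC_mul_phase Ω hσ,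
    integral_switchC_mul_phase Ω hσ]
  congr 6

theorem integral_switchX_mul_cos (Ω : ℝ) {σ : ℝ} (hσ : 0 < σ) (κ : ℝ) :
    ∫ p : ℝ × ℝ, switchX Ω σ p * Complex.cos (κ * (p.1 - p.2) : ℝ) =
      Complex.exp (-(σ ^ 2 * (Ω ^ 2 + κ ^ 2) : ℝ)) := by
  rw [integral_mul_cos (integrable_switchX Ω hσ), integral_switchX_mul_phase Ω hσ,
    integral_switchX_mul_phase Ω hσ, neg_sq]
  ring

/-- The distribution of the time difference `s = t - t'` under `switchX`. -/
noncomputable def relativeSwitch (Ω σ : ℝ) (s : ℝ) : ℝ :=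
  1 / (2 * Real.sqrt Real.pi * σ) * Real.exp (-(σ ^ 2 * Ω ^ 2) - s ^ 2 / (4 * σ ^ 2))

/-- Completing the square in `t` at fixed `s` produces a phase `-iΩs` that cancels the explicit
`iΩs`, so the resulting weight is real, even and Gaussian in `s`. -/
theorem integral_switchX_shear (Ω : ℝ) {σ : ℝ} (hσ : 0 < σ) (s : ℝ) :
    ∫ t : ℝ, switchX Ω σ (t + s, t) = relativeSwitch Ω σ s := by
  have hpi := Real.pi_pos
  have hσ' : (σ : ℂ) ≠ 0 := by exact_mod_cast hσ.ne'
  have h := integral_cexp_neg_mul_sq_add (a := 1 / σ ^ 2) (by positivity)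
    (2 * Complex.I * Ω - s / σ ^ 2) (Complex.I * Ω * s - s ^ 2 / (2 * σ ^ 2))
  have h2 : ∀ t : ℝ, switchX Ω σ (t + s, t) = (1 / (2 * Real.pi * σ ^ 2) : ℝ) * Complex.exp
      (-((1 / σ ^ 2 : ℝ) : ℂ) * (t : ℂ) ^ 2 + (2 * Complex.I * Ω - s / σ ^ 2) * t +
        (Complex.I * Ω * s - s ^ 2 / (2 * σ ^ 2))) := by
    intro t
    have hs : (1 / Real.sqrt (2 * Real.pi * σ ^ 2)) * (1 / Real.sqrt (2 * Real.pi * σ ^ 2)) =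
        1 / (2 * Real.pi * σ ^ 2) := by
      rw [div_mul_div_comm, one_mul, Real.mul_self_sqrt (by positivity)]
    rw [← hs, switchX, gaussianSwitching, gaussianSwitching]
    simp only [Complex.ofReal_mul, Complex.ofReal_exp]
    rw [mul_mul_mul_comm, ← Complex.exp_add, mul_assoc, ← Complex.exp_add]
    congr 2
    push_cast
    field_simp
    ring
  simp_rw [h2]
  rw [integral_const_mul, h, relativeSwitch]
  have h3 : Real.sqrt (Real.pi / (1 / σ ^ 2)) = Real.sqrt Real.pi * σ := by
    rw [div_div_eq_mul_div, div_one, Real.sqrt_mul hpi.le, Real.sqrt_sq hσ.le]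
  rw [h3, Complex.ofReal_mul (1 / (2 * Real.sqrt Real.pi * σ)), Complex.ofReal_exp, ← mul_assoc,
    ← Complex.ofReal_mul]
  congr 1
  · congr 1
    have : Real.sqrt Real.pi * Real.sqrt Real.pi = Real.pi := Real.mul_self_sqrt hpi.le
    have h4 : 0 < Real.sqrt Real.pi := Real.sqrt_pos.2 hpi
    nth_rw 1 [← this]
    field_simp
  · congr 1
    push_cast
    field_simp
    ring_nf
    rw [Complex.I_sq]
    ring

theorem integral_switchX_mul_comp_sub (Ω : ℝ) {σ : ℝ} (hσ : 0 < σ) {q : ℝ → ℂ} (hq : Continuous q)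
    {c : ℝ} (hb : ∀ s, ‖q s‖ ≤ c) :
    ∫ p : ℝ × ℝ, switchX Ω σ p * q (p.1 - p.2) = ∫ s : ℝ, relativeSwitch Ω σ s * q s := by
  set F : ℝ × ℝ → ℂ := fun p => switchX Ω σ p * q (p.1 - p.2) with hF
  have hFi : Integrable F := (integrable_switchX Ω hσ).mul_bdd (c := c)
    (Continuous.aestronglyMeasurable (by fun_prop)) (Eventually.of_forall fun p => hb _)
  -- The change of variables `(s, t') ↦ (t' + s, t')` is a shear followed by a swap.
  have hmp : MeasurePreserving (fun z : ℝ × ℝ => (z.2 + z.1, z.2))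
      ((volume : Measure ℝ).prod volume) (volume.prod volume) :=
    Measure.measurePreserving_swap.comp
      (measurePreserving_prod_add_swap (volume : Measure ℝ) (volume : Measure ℝ))
  have hFc : Integrable (fun z : ℝ × ℝ => F (z.2 + z.1, z.2)) :=
    hmp.integrable_comp_of_integrable hFi
  have h1 : ∫ p, F p = ∫ z : ℝ × ℝ, F (z.2 + z.1, z.2) := by
    have := integral_map (μ := (volume : Measure ℝ).prod volume) hmp.measurable.aemeasurable
      (f := F) (by rw [hmp.map_eq]; exact hFi.aestronglyMeasurable)
    rwa [hmp.map_eq] at this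
  rw [h1, Measure.volume_eq_prod, integral_prod _ hFc]
  congr 1 with s
  rw [← integral_switchX_shear Ω hσ s, ← integral_mul_const]
  simp [hF]

theorem continuous_relativeSwitch (Ω σ : ℝ) : Continuous (relativeSwitch Ω σ) := by
  unfold relativeSwitch
  fun_prop

/-- Time ordering makes the integrand even in `s`, so twice the half-line integral remains. The
half-line sine transform has no Gaussian decay in `κ`: its boundary term at `s = 0` is of order
`1/κ`. -/
theorem integral_switchX_mul_sin_abs (Ω : ℝ) {σ : ℝ} (hσ : 0 < σ) (κ : ℝ) :
    ∫ p : ℝ × ℝ, switchX Ω σ p * (-Complex.I * Complex.sin (κ * |p.1 - p.2| : ℝ)) =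
      -2 * Complex.I * ∫ s in Set.Ioi (0 : ℝ), (relativeSwitch Ω σ s * Real.sin (κ * s) : ℂ) := by
  rw [integral_switchX_mul_comp_sub Ω hσ (q := fun s => -Complex.I * Complex.sin (κ * |s| : ℝ))
    (c := 1) (by fun_prop)]
  · have := integral_comp_abs (f := fun s => relativeSwitch Ω σ s * Real.sin (κ * s))
    have h2 : ∀ s : ℝ, (relativeSwitch Ω σ s : ℂ) * (-Complex.I * Complex.sin (κ * |s| : ℝ)) =
        -Complex.I * ((relativeSwitch Ω σ |s| * Real.sin (κ * |s|) : ℝ) : ℂ) := by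
      intro s
      simp only [relativeSwitch, sq_abs]
      push_cast
      ring
    simp_rw [h2]
    rw [integral_const_mul, integral_complex_ofReal, this, Complex.ofReal_mul,
      ← integral_complex_ofReal]
    push_cast
    ring
  · intro s
    rw [norm_mul, norm_neg, Complex.norm_I, one_mul, ← Complex.ofReal_sin, Complex.norm_real]
    exact Real.abs_sin_le_one _

/-! ### The pointlike limit -/

theorem eventually_deltaFilter (x₀ : Space) {r : ℝ} (hr : 0 < r) :
    ∀ᶠ f : 𝓢(Space, ℝ) in deltaFilter x₀, (∀ x, 0 ≤ f x) ∧ ∫ x, f x = 1 ∧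
      Function.support f ⊆ Metric.ball x₀ r :=
  mem_iInf_of_mem (⟨r, hr⟩ : Set.Ioi (0 : ℝ)) (mem_principal_self _)

/-- The radii `1/(n+1)` are cofinal. Countable generation is what dominated convergence along a
filter requires. -/
instance deltaFilter_isCountablyGenerated (x₀ : Space) :
    (deltaFilter x₀).IsCountablyGenerated := by
  have h : deltaFilter x₀ = ⨅ n : ℕ, 𝓟 {f : 𝓢(Space, ℝ) | (∀ x, 0 ≤ f x) ∧ ∫ x, f x = 1 ∧
      Function.support f ⊆ Metric.ball x₀ (1 / ((n : ℝ) + 1))} := by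
    refine le_antisymm (le_iInf fun n => ?_) (le_iInf fun r => ?_)
    · exact iInf_le _ (⟨1 / ((n : ℝ) + 1), Set.mem_Ioi.2 (by positivity)⟩ : Set.Ioi (0 : ℝ))
    · obtain ⟨n, hn⟩ := exists_nat_one_div_lt (Set.mem_Ioi.1 r.2)
      exact iInf_le_of_le n (principal_mono.2 fun f hf =>
        ⟨hf.1, hf.2.1, hf.2.2.trans (Metric.ball_subset_ball hn.le)⟩)
  rw [h]
  exact isCountablyGenerated_seq _

/-- Such an `f` is a probability density on the ball, so an average of values within `ε` of `L`
stays within `ε` of `L`. Integrability of `φ` itself is not assumed; the bound provides it where `f`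
lives. -/
theorem norm_integral_mul_sub_le {f : 𝓢(Space, ℝ)} {x₀ : Space} {r ε : ℝ} (hf0 : ∀ x, 0 ≤ f x)
    (hf1 : ∫ x, f x = 1) (hfs : Function.support f ⊆ Metric.ball x₀ r) {φ : Space → ℂ}
    (hφ : AEStronglyMeasurable φ) {L : ℂ} (hL : ∀ x ∈ Metric.ball x₀ r, ‖φ x - L‖ ≤ ε) :
    ‖(∫ x, (f x : ℂ) * φ x) - L‖ ≤ ε := by
  have hfi : Integrable (fun x => f x) := f.integrable
  have hb : ∀ x, ‖(f x : ℂ) * (φ x - L)‖ ≤ f x * ε := by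
    intro x
    rw [norm_mul, Complex.norm_real, Real.norm_of_nonneg (hf0 x)]
    by_cases hx : f x = 0
    · simp [hx]
    · exact mul_le_mul_of_nonneg_left (hL x (hfs hx)) (hf0 x)
  have hi1 : Integrable fun x => (f x : ℂ) * (φ x - L) :=
    (hfi.mul_const ε).mono' (hfi.ofReal.aestronglyMeasurable.mul
      (hφ.sub aestronglyMeasurable_const)) (Eventually.of_forall hb)
  have hi2 : Integrable fun x => (f x : ℂ) * L := hfi.ofReal.mul_const L
  have h : (∫ x, (f x : ℂ) * φ x) - L = ∫ x, (f x : ℂ) * (φ x - L) := by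
    have h1 : ∫ x, (f x : ℂ) * L = L := by
      rw [integral_mul_const, integral_complex_ofReal, hf1, Complex.ofReal_one, one_mul]
    have h2 := integral_add hi1 hi2
    rw [h1] at h2
    rw [sub_eq_iff_eq_add, ← h2]
    congr 1 with x
    ring
  rw [h]
  calc _ ≤ ∫ x, f x * ε :=
        norm_integral_le_of_norm_le (hfi.mul_const ε) (Eventually.of_forall hb)
    _ = ε := by rw [integral_mul_const, hf1, one_mul]

theorem tendsto_integral_deltaFilter {x₀ : Space} {φ : Space → ℂ} (hφ : AEStronglyMeasurable φ)
    (hc : ContinuousAt φ x₀) :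
    Tendsto (fun f : 𝓢(Space, ℝ) => ∫ x, (f x : ℂ) * φ x) (deltaFilter x₀) (𝓝 (φ x₀)) := by
  rw [Metric.tendsto_nhds]
  intro ε hε
  obtain ⟨r, hr, h⟩ := Metric.continuousAt_iff.1 hc (ε / 2) (half_pos hε)
  filter_upwards [eventually_deltaFilter x₀ hr] with f hf
  rw [dist_eq_norm]
  refine (norm_integral_mul_sub_le hf.1 hf.2.1 hf.2.2 hφ fun x hx => ?_).trans_lt (half_lt_self hε)
  rw [← dist_eq_norm]
  exact (h hx).le

/-- Continuity is asked only at `a - b`, since the kernel this serves is singular at the origin. The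
averaging estimate is applied in `y` and then in `x`. -/
theorem tendsto_integral_integral_deltaFilter {ι : Type*} {l : Filter ι} {a b : Space}
    {F G : ι → 𝓢(Space, ℝ)} (hF : Tendsto F l (deltaFilter a)) (hG : Tendsto G l (deltaFilter b))
    {u : Space → ℂ} (hu : Measurable u) (hc : ContinuousAt u (a - b)) :
    Tendsto (fun i => ∫ x, (F i x : ℂ) * ∫ y, (G i y : ℂ) * u (x - y)) l (𝓝 (u (a - b))) := by
  rw [Metric.tendsto_nhds]
  intro ε hε
  obtain ⟨r, hr, h⟩ := Metric.continuousAt_iff.1 hc (ε / 2) (half_pos hε)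
  -- Radius `r / 2` for each smearing keeps `x - y` within `r` of `a - b`.
  filter_upwards [hF.eventually (eventually_deltaFilter a (half_pos hr)),
    hG.eventually (eventually_deltaFilter b (half_pos hr))] with i hf hg
  rw [dist_eq_norm]
  have hm : StronglyMeasurable fun x => ∫ y, (G i y : ℂ) * u (x - y) := by
    have : StronglyMeasurable (Function.uncurry fun x y : Space => (G i y : ℂ) * u (x - y)) := by
      have h1 : Continuous (G i) := (G i).continuous
      refine Measurable.stronglyMeasurable ?_
      have h2 : Measurable fun p : Space × Space => (G i p.2 : ℂ) :=
        Complex.measurable_ofReal.comp (h1.measurable.comp measurable_snd)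
      exact h2.mul (hu.comp (measurable_fst.sub measurable_snd))
    exact this.integral_prod_right
  refine (norm_integral_mul_sub_le hf.1 hf.2.1 hf.2.2 hm.aestronglyMeasurable
    fun x hx => ?_).trans_lt (half_lt_self hε)
  have hux : Measurable fun y => u (x - y) := hu.comp (by fun_prop)
  refine norm_integral_mul_sub_le hg.1 hg.2.1 hg.2.2 hux.aestronglyMeasurable fun y hy => ?_
  rw [← dist_eq_norm]
  refine (h ?_).le
  rw [dist_eq_norm, show x - y - (a - b) = (x - a) - (y - b) by abel]
  refine (norm_sub_le _ _).trans_lt ?_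
  rw [← dist_eq_norm, ← dist_eq_norm]
  rw [Metric.mem_ball] at hx hy
  linarith

theorem tendsto_fourierProfile (x₀ k : Space) :
    Tendsto (fun f => fourierProfile f k) (deltaFilter x₀)
      (𝓝 (Complex.exp (-Complex.I * (inner ℝ k x₀ : ℝ)))) := by
  have hc : Continuous fun x : Space => Complex.exp (-Complex.I * (inner ℝ k x : ℝ)) := by fun_prop
  exact tendsto_integral_deltaFilter hc.aestronglyMeasurable hc.continuousAt

theorem norm_fourierProfile_le {f : 𝓢(Space, ℝ)} (hf0 : ∀ x, 0 ≤ f x) (hf1 : ∫ x, f x = 1)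
    (k : Space) : ‖fourierProfile f k‖ ≤ 1 := by
  rw [← hf1]
  refine norm_integral_le_of_norm_le f.integrable (Eventually.of_forall fun x => ?_)
  rw [norm_mul, Complex.norm_real, Real.norm_of_nonneg (hf0 x),
    show -Complex.I * (inner ℝ k x : ℝ) = (-(inner ℝ k x : ℝ) : ℝ) * Complex.I by push_cast; ring,
    Complex.norm_exp_ofReal_mul_I, mul_one]

/-- The pointlike limit of a mode sum with integrable spectral density. -/
theorem tendsto_integral_mul_spectralWeight {ι : Type*} {l : Filter ι} [l.IsCountablyGenerated]
    {a b : Space} {F G : ι → 𝓢(Space, ℝ)} (hF : Tendsto F l (deltaFilter a))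
    (hG : Tendsto G l (deltaFilter b)) {M : ℝ → ℂ} (hM : Continuous M)
    (hMi : Integrable fun k : Space => M ‖k‖ / ‖k‖) :
    Tendsto (fun i => ∫ k, M ‖k‖ * spectralWeight (F i) (G i) k) l
      (𝓝 (∫ k : Space, M ‖k‖ * (Complex.exp (Complex.I * (inner ℝ k (a - b) : ℝ)) /
        ((2 * Real.pi) ^ 3 * (2 * ‖k‖) : ℝ)))) := by
  refine tendsto_integral_filter_of_dominated_convergence
    (fun k => ((2 * Real.pi) ^ 3 * 2)⁻¹ * ‖M ‖k‖ / ‖k‖‖) ?_ ?_ (hMi.norm.const_mul _) ?_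
  · exact Eventually.of_forall fun i => ((hM.comp continuous_norm).aestronglyMeasurable).mul
      (integrable_spectralWeight _ _).aestronglyMeasurable
  -- Only positivity and unit mass matter here, giving profiles bounded by 1; the radius 1 is
  -- arbitrary.
  · filter_upwards [hF.eventually (eventually_deltaFilter a one_pos),
      hG.eventually (eventually_deltaFilter b one_pos)] with i hf hg
    refine Eventually.of_forall fun k => ?_
    have h1 := norm_fourierProfile_le hf.1 hf.2.1 k
    have h2 := norm_fourierProfile_le hg.1 hg.2.1 k
    have h3 : ‖fourierProfile (F i) k‖ * ‖fourierProfile (G i) k‖ ≤ 1 :=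
      mul_le_one₀ h1 (norm_nonneg _) h2
    have h0 : (0 : ℝ) ≤ (2 * Real.pi) ^ 3 * (2 * ‖k‖) := by positivity
    rw [spectralWeight, norm_mul, norm_div, norm_mul, RCLike.norm_conj, Complex.norm_real,
      Real.norm_of_nonneg h0, norm_div, Complex.norm_real, norm_norm]
    calc _ ≤ ‖M ‖k‖‖ * (1 / ((2 * Real.pi) ^ 3 * (2 * ‖k‖))) := by gcongr
      _ = _ := by rw [← mul_assoc, one_div, mul_inv]; ring
  · refine Eventually.of_forall fun k => Tendsto.const_mul _ (Tendsto.div_const ?_ _)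
    have h1 := (Complex.continuous_conj.tendsto _).comp ((tendsto_fourierProfile a k).comp hF)
    have h2 := (tendsto_fourierProfile b k).comp hG
    have he : Complex.exp (Complex.I * (inner ℝ k (a - b) : ℝ)) =
        conj (Complex.exp (-Complex.I * (inner ℝ k a : ℝ))) *
          Complex.exp (-Complex.I * (inner ℝ k b : ℝ)) := by
      rw [← Complex.exp_conj, ← Complex.exp_add, inner_sub_right]
      congr 1
      simp
      ring
    rw [he]
    exact h1.mul h2

/-! ### Fourier transform of radial functions on three-dimensional space -/

/-- The distribution of the radius in the plane. -/
theorem map_radius_volume :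
    Measure.map (fun q : ℝ × ℝ => Real.sqrt (q.1 ^ 2 + q.2 ^ 2)) volume =
      (volume : Measure ℝ).withDensity fun ρ => (Real.toNNReal (2 * Real.pi * ρ) : NNReal) := by
  have hm : Measurable fun q : ℝ × ℝ => Real.sqrt (q.1 ^ 2 + q.2 ^ 2) := by fun_prop
  ext s hs
  have hmρ : Measurable fun ρ : ℝ => ENNReal.ofReal ρ * s.indicator 1 ρ :=
    ENNReal.measurable_ofReal.mul (measurable_one.indicator hs)
  rw [Measure.map_apply hm hs, withDensity_apply _ hs, ← lintegral_indicator_one (hm hs),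
    ← lintegral_comp_polarCoord_symm]
  have h1 : ∀ p ∈ polarCoord.target, ENNReal.ofReal p.1 •
      ((fun q : ℝ × ℝ => Real.sqrt (q.1 ^ 2 + q.2 ^ 2)) ⁻¹' s).indicator
        (1 : ℝ × ℝ → ENNReal) (polarCoord.symm p) =
        (ENNReal.ofReal p.1 * s.indicator 1 p.1) * 1 := by
    intro p hp
    have hp1 : 0 < p.1 := hp.1
    have h2 : Real.sqrt ((p.1 * Real.cos p.2) ^ 2 + (p.1 * Real.sin p.2) ^ 2) = p.1 := by
      rw [mul_pow, mul_pow, ← mul_add, Real.cos_sq_add_sin_sq, mul_one, Real.sqrt_sq hp1.le]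
    rw [smul_eq_mul, mul_one]
    congr 1
    change s.indicator (1 : ℝ → ENNReal)
      (Real.sqrt ((p.1 * Real.cos p.2) ^ 2 + (p.1 * Real.sin p.2) ^ 2)) = _
    rw [h2]
  rw [setLIntegral_congr_fun polarCoord.open_target.measurableSet h1, polarCoord_target,
    Measure.volume_eq_prod, ← Measure.prod_restrict,
    lintegral_prod_mul (f := fun ρ => ENNReal.ofReal ρ * s.indicator 1 ρ) (g := fun _ => 1)
      hmρ.aemeasurable aemeasurable_const]
  rw [lintegral_one, Measure.restrict_apply_univ, Real.volume_Ioo,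
    ← lintegral_mul_const _ hmρ,
    ← lintegral_indicator measurableSet_Ioi, ← lintegral_indicator hs]
  congr 1 with ρ
  by_cases h1 : ρ ∈ s <;> by_cases h2 : 0 < ρ
  · simp only [Set.indicator, Set.mem_Ioi, h1, h2, if_true, Pi.one_apply, mul_one]
    change _ = ENNReal.ofReal _
    rw [← ENNReal.ofReal_mul h2.le]
    congr 1
    ring
  · have : 2 * Real.pi * ρ ≤ 0 := mul_nonpos_of_nonneg_of_nonpos (by positivity) (not_lt.1 h2)
    simp [Set.indicator, h1, h2, Real.toNNReal_of_nonpos this]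
  · simp [Set.indicator, h1]
  · simp [Set.indicator, h1]

/-- Each regrouping of coordinates is a measure-preserving equivalence, so no regularity of `H` is
needed. -/
theorem integral_space_eq_integral_prod (H : ℝ → ℝ → ℂ) :
    ∫ k : Space, H (k 0) (Real.sqrt (k 1 ^ 2 + k 2 ^ 2)) =
      ∫ p : ℝ × ℝ × ℝ, H p.1 (Real.sqrt (p.2.1 ^ 2 + p.2.2 ^ 2)) := by
  have h1 := (PiLp.volume_preserving_ofLp (Fin 3)).integral_comp
    (MeasurableEquiv.toLp 2 (Fin 3 → ℝ)).symm.measurableEmbedding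
    (fun v : Fin 3 → ℝ => H (v 0) (Real.sqrt (v 1 ^ 2 + v 2 ^ 2)))
  have h2 := (volume_preserving_piFinSuccAbove (fun _ : Fin 3 => ℝ) 0).integral_comp'
    (fun p : ℝ × (Fin 2 → ℝ) => H p.1 (Real.sqrt (p.2 0 ^ 2 + p.2 1 ^ 2)))
  have h3 := ((MeasurePreserving.id (volume : Measure ℝ)).prod
    (volume_preserving_finTwoArrow ℝ)).integral_comp
    ((MeasurableEquiv.refl ℝ).prodCongr MeasurableEquiv.finTwoArrow).measurableEmbedding
    (fun p : ℝ × ℝ × ℝ => H p.1 (Real.sqrt (p.2.1 ^ 2 + p.2.2 ^ 2)))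
  exact h1.trans (h2.trans h3)

/-- The `max` extends the radial density `2πρ` by zero to negative `ρ`. The integral then runs over
a full plane, where polar coordinates can be used a second time. -/
theorem integral_space_eq_integral_cylindrical {H : ℝ → ℝ → ℂ}
    (hH : Measurable (Function.uncurry H)) :
    ∫ k : Space, H (k 0) (Real.sqrt (k 1 ^ 2 + k 2 ^ 2)) =
      ∫ p : ℝ × ℝ, (max (2 * Real.pi * p.2) 0 : ℝ) * H p.1 p.2 := by
  have hm : Measurable fun q : ℝ × ℝ => Real.sqrt (q.1 ^ 2 + q.2 ^ 2) := by fun_prop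
  have hd : Measurable fun ρ : ℝ => Real.toNNReal (2 * Real.pi * ρ) := by fun_prop
  have hsf : SFinite ((volume : Measure ℝ).withDensity fun ρ =>
      (Real.toNNReal (2 * Real.pi * ρ) : NNReal)) := inferInstance
  have h1 : Measure.map (Prod.map id fun q : ℝ × ℝ => Real.sqrt (q.1 ^ 2 + q.2 ^ 2))
      (volume : Measure (ℝ × ℝ × ℝ)) =
      (volume : Measure (ℝ × ℝ)).withDensity fun p =>
        (Real.toNNReal (2 * Real.pi * p.2) : NNReal) := by
    rw [Measure.volume_eq_prod ℝ (ℝ × ℝ), ← Measure.map_prod_map _ _ measurable_id hm,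
      map_radius_volume, Measure.map_id, prod_withDensity_right hd.coe_nnreal_ennreal, Measure.volume_eq_prod]
  rw [integral_space_eq_integral_prod]
  have h2 := integral_map (μ := (volume : Measure (ℝ × ℝ × ℝ)))
    (measurable_id.prodMap hm).aemeasurable (f := Function.uncurry H)
    hH.stronglyMeasurable.aestronglyMeasurable
  rw [h1, integral_withDensity_eq_integral_smul (by fun_prop)] at h2
  refine h2.symm.trans (integral_congr_ae (Eventually.of_forall fun p => ?_))
  simp [NNReal.smul_def, Function.uncurry]

/-- An antiderivative is `(i/a) e^{ia cos θ}`. -/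
theorem integral_sin_mul_cexp_cos {a : ℝ} (ha : a ≠ 0) :
    ∫ θ in (0 : ℝ)..Real.pi, (Real.sin θ : ℂ) * Complex.exp (Complex.I * (a * Real.cos θ : ℝ)) =
      2 * Real.sin a / a := by
  have ha' : (a : ℂ) ≠ 0 := by exact_mod_cast ha
  have hd : ∀ θ ∈ Set.uIcc (0 : ℝ) Real.pi, HasDerivAt
      (fun θ : ℝ => Complex.exp (Complex.I * (a * Real.cos θ : ℝ)) * (Complex.I / a))
      ((Real.sin θ : ℂ) * Complex.exp (Complex.I * (a * Real.cos θ : ℝ))) θ := by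
    intro θ _
    have h1 : HasDerivAt (fun θ : ℝ => ((a * Real.cos θ : ℝ) : ℂ)) ((a * -Real.sin θ : ℝ) : ℂ) θ :=
      ((Real.hasDerivAt_cos θ).const_mul a).ofReal_comp
    refine ((h1.const_mul Complex.I).cexp.mul_const (Complex.I / a)).congr_deriv ?_
    have h2 : Complex.I * ((a * -Real.sin θ : ℝ) : ℂ) * (Complex.I / a) = Real.sin θ := by
      push_cast
      field_simp
      rw [Complex.I_sq]
      ring
    rw [mul_assoc, h2, mul_comm]
  rw [intervalIntegral.integral_eq_sub_of_hasDerivAt hd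
    (Continuous.intervalIntegrable (by fun_prop) _ _), Complex.ofReal_sin, Complex.sin]
  simp only [Real.cos_pi, Real.cos_zero]
  field_simp
  push_cast
  ring_nf

theorem integral_max_sin_mul_cexp_cos {a : ℝ} (ha : a ≠ 0) :
    ∫ θ in Set.Ioo (-Real.pi) Real.pi,
      ((max (Real.sin θ) 0 : ℝ) : ℂ) * Complex.exp (Complex.I * (a * Real.cos θ : ℝ)) =
      2 * Real.sin a / a := by
  have hpi := Real.pi_pos
  have hc : Continuous fun θ : ℝ =>
      ((max (Real.sin θ) 0 : ℝ) : ℂ) * Complex.exp (Complex.I * (a * Real.cos θ : ℝ)) := by fun_prop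
  rw [← integral_Ioc_eq_integral_Ioo, ← intervalIntegral.integral_of_le (by linarith),
    ← intervalIntegral.integral_add_adjacent_intervals (b := 0) (hc.intervalIntegrable _ _)
      (hc.intervalIntegrable _ _), ← integral_sin_mul_cexp_cos ha]
  have h1 : ∫ θ in (-Real.pi)..0, ((max (Real.sin θ) 0 : ℝ) : ℂ) *
      Complex.exp (Complex.I * (a * Real.cos θ : ℝ)) = ∫ θ in (-Real.pi)..0, (0 : ℂ) := by
    refine intervalIntegral.integral_congr fun θ hθ => ?_
    rw [Set.uIcc_of_le (by linarith)] at hθ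
    have : Real.sin θ ≤ 0 := Real.sin_nonpos_of_nonpos_of_neg_pi_le hθ.2 hθ.1
    simp only [max_eq_right this, Complex.ofReal_zero, zero_mul]
  rw [h1, intervalIntegral.integral_zero, zero_add]
  refine intervalIntegral.integral_congr fun θ hθ => ?_
  rw [Set.uIcc_of_le hpi.le] at hθ
  have : 0 ≤ Real.sin θ := Real.sin_nonneg_of_mem_Icc hθ
  simp only [max_eq_left this]

/-- Two vectors of equal norm are exchanged by the reflection in the hyperplane orthogonal to their
difference. -/
theorem exists_linearIsometryEquiv_map_single (x : Space) :
    ∃ e : Space ≃ₗᵢ[ℝ] Space, e x = EuclideanSpace.single 0 ‖x‖ := by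
  refine ⟨(ℝ ∙ (x - EuclideanSpace.single 0 ‖x‖))ᗮ.reflection, Submodule.reflection_sub ?_⟩
  simp

theorem integral_cexp_inner_mul_radial_eq_axis (R : ℝ → ℂ) (x : Space) :
    ∫ k : Space, Complex.exp (Complex.I * (inner ℝ k x : ℝ)) * R ‖k‖ =
      ∫ k : Space, Complex.exp (Complex.I * (‖x‖ * k 0 : ℝ)) * R ‖k‖ := by
  obtain ⟨e, he⟩ := exists_linearIsometryEquiv_map_single x
  have h := e.measurePreserving.integral_comp e.toHomeomorph.measurableEmbedding
    (fun k : Space => Complex.exp (Complex.I * (‖x‖ * k 0 : ℝ)) * R ‖k‖)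
  rw [← h]
  congr 1 with k
  have h1 : inner ℝ k x = ‖x‖ * (e k) 0 := by
    rw [← e.inner_map_map, he, EuclideanSpace.inner_single_right]
    simp
  rw [h1, e.norm_map]

theorem norm_space_eq (k : Space) :
    ‖k‖ = Real.sqrt (k 0 ^ 2 + Real.sqrt (k 1 ^ 2 + k 2 ^ 2) ^ 2) := by
  rw [EuclideanSpace.norm_eq, Fin.sum_univ_three, Real.sq_sqrt (by positivity)]
  simp [add_assoc]

/-- The Fourier transform of a radial function on `ℝ³` as a one-dimensional sine transform. -/
theorem integral_cexp_inner_mul_radial {R : ℝ → ℂ} (hR : Measurable R)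
    (hRi : IntegrableOn (fun r : ℝ => (r ^ 2 : ℂ) * R r) (Set.Ioi 0)) {x : Space} (hx : x ≠ 0) :
    ∫ k : Space, Complex.exp (Complex.I * (inner ℝ k x : ℝ)) * R ‖k‖ =
      4 * Real.pi / ‖x‖ * ∫ r in Set.Ioi (0 : ℝ), (r * Real.sin (‖x‖ * r) : ℂ) * R r := by
  set d : ℝ := ‖x‖ with hd
  have hd0 : 0 < d := norm_pos_iff.2 hx
  have hH : Measurable (Function.uncurry fun z ρ : ℝ =>
      Complex.exp (Complex.I * (d * z : ℝ)) * R (Real.sqrt (z ^ 2 + ρ ^ 2))) := by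
    refine Measurable.mul (by fun_prop) (hR.comp (by fun_prop))
  have h1 := integral_space_eq_integral_cylindrical hH
  simp_rw [← norm_space_eq] at h1
  -- Spherical coordinates arise from two planar polar changes: first around the axis of `x`, then
  -- in the half plane `(z, ρ) = (r cos θ, r sin θ)`.
  rw [integral_cexp_inner_mul_radial_eq_axis, ← hd, h1, ← integral_comp_polarCoord_symm]
  have h2 : ∀ p ∈ polarCoord.target, p.1 •
      (((max (2 * Real.pi * (polarCoord.symm p).2) 0 : ℝ) : ℂ) *
      (Complex.exp (Complex.I * (d * (polarCoord.symm p).1 : ℝ)) *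
        R (Real.sqrt ((polarCoord.symm p).1 ^ 2 + (polarCoord.symm p).2 ^ 2)))) =
      (((p.1 : ℂ) ^ 2) * R p.1) * ((2 * Real.pi) * (((max (Real.sin p.2) 0 : ℝ) : ℂ) *
        Complex.exp (Complex.I * (d * p.1 * Real.cos p.2 : ℝ)))) := by
    intro p hp
    have hp1 : 0 < p.1 := hp.1
    have h3 : Real.sqrt ((p.1 * Real.cos p.2) ^ 2 + (p.1 * Real.sin p.2) ^ 2) = p.1 := by
      rw [mul_pow, mul_pow, ← mul_add, Real.cos_sq_add_sin_sq, mul_one, Real.sqrt_sq hp1.le]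
    have h4 : max (2 * Real.pi * (p.1 * Real.sin p.2)) 0 =
        2 * Real.pi * p.1 * max (Real.sin p.2) 0 := by
      rw [mul_max_of_nonneg _ _ (by positivity), mul_zero]
      ring_nf
    rw [polarCoord_symm_apply, Complex.real_smul]
    simp only [h3, h4]
    rw [← mul_assoc d p.1]
    push_cast
    ring
  rw [setIntegral_congr_fun polarCoord.open_target.measurableSet h2, polarCoord_target,
    Measure.volume_eq_prod, setIntegral_prod]
  · rw [← integral_const_mul]
    refine setIntegral_congr_fun measurableSet_Ioi fun r hr => ?_
    have hr : 0 < r := hr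
    have hdr : d * r ≠ 0 := (mul_pos hd0 hr).ne'
    have hdc : (d : ℂ) ≠ 0 := by exact_mod_cast hd0.ne'
    have hrc : (r : ℂ) ≠ 0 := by exact_mod_cast hr.ne'
    simp only
    rw [integral_const_mul, integral_const_mul, integral_max_sin_mul_cexp_cos hdr]
    push_cast
    field_simp
    ring
  · rw [IntegrableOn, ← Measure.prod_restrict]
    have h5 : IntegrableOn (fun _ : ℝ => (1 : ℂ)) (Set.Ioo (-Real.pi) Real.pi) := by
      simp
    refine ((hRi.mul_prod h5).mul_bdd (c := 2 * Real.pi) (g := fun p : ℝ × ℝ =>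
      (2 * Real.pi) * (((max (Real.sin p.2) 0 : ℝ) : ℂ) *
        Complex.exp (Complex.I * (d * p.1 * Real.cos p.2 : ℝ))))
      (Continuous.aestronglyMeasurable (by fun_prop)) (Eventually.of_forall fun p => ?_)).congr
      (Eventually.of_forall fun p => ?_)
    · have h6 : |max (Real.sin p.2) 0| ≤ 1 := by
        rw [abs_of_nonneg (le_max_right _ _)]
        exact max_le (Real.sin_le_one _) zero_le_one
      have h7 : ‖(2 * Real.pi : ℂ)‖ = 2 * Real.pi := by
        rw [← Complex.ofReal_ofNat, ← Complex.ofReal_mul, Complex.norm_real,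
          Real.norm_of_nonneg (by positivity)]
      rw [norm_mul, h7, norm_mul, mul_comm Complex.I, Complex.norm_exp_ofReal_mul_I, mul_one,
        Complex.norm_real, Real.norm_eq_abs]
      exact mul_le_of_le_one_right (by positivity) h6
    · simp

open FourierTransform

/-! ### Convolution against an integrable kernel in momentum space -/

/-- Fourier transform `∫ d³y u(y) e^{-i k·y}`. -/
noncomputable def fourierKernel (u : Space → ℂ) (k : Space) : ℂ :=
  ∫ y : Space, Complex.exp (-Complex.I * (inner ℝ k y : ℝ)) * u y

theorem norm_cexp_neg_I_mul (a : ℝ) : ‖Complex.exp (-Complex.I * (a : ℝ))‖ = 1 := by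
  rw [show -Complex.I * (a : ℂ) = ((-a : ℝ) : ℂ) * Complex.I by push_cast; ring,
    Complex.norm_exp_ofReal_mul_I]

theorem norm_fourierKernel_le (u : Space → ℂ) (k : Space) : ‖fourierKernel u k‖ ≤ ∫ y, ‖u y‖ := by
  refine (norm_integral_le_integral_norm _).trans_eq ?_
  simp only [norm_mul, norm_cexp_neg_I_mul, one_mul]

theorem continuous_fourierKernel {u : Space → ℂ} (hu : Integrable u) :
    Continuous (fourierKernel u) := by
  refine continuous_of_dominated (bound := fun y => ‖u y‖) (fun k => ?_) (fun k => ?_) hu.norm ?_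
  · exact Continuous.aestronglyMeasurable (by fun_prop) |>.mul hu.aestronglyMeasurable
  · refine Eventually.of_forall fun y => ?_
    rw [norm_mul, norm_cexp_neg_I_mul, one_mul]
  · exact Eventually.of_forall fun y => by fun_prop

theorem integrable_fourierProfile (g : 𝓢(Space, ℝ)) : Integrable (fourierProfile g) := by
  have h := (FourierTransform.fourier (g.postcompCLM Complex.ofRealCLM) : 𝓢(Space, ℂ)).integrable
    (μ := volume)
  have h2 := h.comp_smul (R := (2 * Real.pi)⁻¹) (by positivity)
  exact h2.congr (Eventually.of_forall fun k => (fourierProfile_eq g k).symm)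

theorem fourierKernel_translate (u : Space → ℂ) (x k : Space) :
    fourierKernel (fun y => u (y + x)) k =
      Complex.exp (Complex.I * (inner ℝ k x : ℝ)) * fourierKernel u k := by
  rw [fourierKernel, fourierKernel, ← integral_const_mul]
  rw [← integral_add_right_eq_self (fun y => Complex.exp (Complex.I * (inner ℝ k x : ℝ)) *
    (Complex.exp (-Complex.I * (inner ℝ k y : ℝ)) * u y)) x]
  congr 1 with y
  rw [← mul_assoc, ← Complex.exp_add, inner_add_right]
  congr 2
  push_cast
  ring

theorem fourierKernel_two_pi_smul (u : Space → ℂ) (k : Space) :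
    fourierKernel u ((2 * Real.pi) • k) = 𝓕 u k := by
  rw [Real.fourier_eq', fourierKernel]
  congr 1 with y
  rw [smul_eq_mul, real_inner_smul_left, real_inner_comm]
  congr 2
  push_cast
  ring

/-- The Fourier transform is moved from `u` onto the Schwartz factor, where inversion is available,
so `u` need only be integrable. The factor `(2π)³` is the Jacobian between the two Fourier
conventions. -/
theorem integral_fourierKernel_mul_fourierProfile {u : Space → ℂ} (hu : Integrable u)
    (g : 𝓢(Space, ℝ)) :
    ∫ k, fourierKernel u k * fourierProfile g k = (2 * Real.pi) ^ 3 * ∫ y, u y * g (-y) := by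
  set G : 𝓢(Space, ℂ) := g.postcompCLM Complex.ofRealCLM with hG
  set H : 𝓢(Space, ℂ) := 𝓕 G with hH
  have h1 := Measure.integral_comp_smul (volume : Measure Space)
    (fun k => fourierKernel u k * fourierProfile g k) (2 * Real.pi)
  have h2 : ∀ k : Space, fourierKernel u ((2 * Real.pi) • k) *
      fourierProfile g ((2 * Real.pi) • k) = 𝓕 u k • H k := by
    intro k
    rw [fourierKernel_two_pi_smul, fourierProfile_eq, inv_smul_smul₀ (by positivity), smul_eq_mul]
  simp_rw [h2] at h1
  have h3 : ∫ k, 𝓕 u k • H k = ∫ y, u y • 𝓕 (H : Space → ℂ) y := by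
    have := VectorFourier.integral_fourierIntegral_smul_eq_flip (L := innerₗ Space)
      (μ := volume) (ν := volume) (f := u) (g := H)
      Real.continuous_fourierChar continuous_inner hu H.integrable
    rw [flip_innerₗ] at this
    exact this
  have h4 : ∀ y, 𝓕 (H : Space → ℂ) y = g (-y) := by
    intro y
    have h5 : 𝓕⁻ H = G := FourierTransform.fourierInv_fourier_eq G
    have h6 := congrArg (fun F : 𝓢(Space, ℂ) => F (-y)) h5
    simp only [SchwartzMap.fourierInv_coe] at h6
    rw [Real.fourierInv_eq_fourier_neg, neg_neg] at h6
    rw [h6]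
    rfl
  rw [h3] at h1
  simp_rw [h4, smul_eq_mul] at h1
  rw [h1]
  have : (2 * Real.pi : ℂ) ≠ 0 := by simp
  simp only [finrank_euclideanSpace, Fintype.card_fin, Complex.real_smul]
  rw [abs_of_pos (by positivity)]
  push_cast
  field_simp

/-- Writing the conjugated profile as an integral over `x` produces phases `e^{ik·x}`, which
translate `u`. After Fubini, each `x` is an instance of the previous identity. -/
theorem integral_fourierKernel_mul_conj_mul {u : Space → ℂ} (hu : Integrable u)
    (f g : 𝓢(Space, ℝ)) :
    ∫ k, fourierKernel u k * (conj (fourierProfile f k) * fourierProfile g k) =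
      (2 * Real.pi) ^ 3 * ∫ x, (f x : ℂ) * ∫ y, (g y : ℂ) * u (x - y) := by
  have hi : Integrable fun k => fourierKernel u k * fourierProfile g k :=
    (integrable_fourierProfile g).bdd_mul (continuous_fourierKernel hu).aestronglyMeasurable
      (Eventually.of_forall (norm_fourierKernel_le u))
  have hf : Integrable fun x => (f x : ℂ) := f.integrable.ofReal
  have hprod : Integrable (Function.uncurry fun (k x : Space) =>
      Complex.exp (Complex.I * (inner ℝ k x : ℝ)) *
        ((fourierKernel u k * fourierProfile g k) * (f x : ℂ))) := by
    refine (hi.mul_prod hf).bdd_mul (c := 1) (Continuous.aestronglyMeasurable (by fun_prop))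
      (Eventually.of_forall fun p => ?_)
    rw [mul_comm, Complex.norm_exp_ofReal_mul_I]
  calc ∫ k, fourierKernel u k * (conj (fourierProfile f k) * fourierProfile g k)
      = ∫ k, ∫ x, Complex.exp (Complex.I * (inner ℝ k x : ℝ)) *
        ((fourierKernel u k * fourierProfile g k) * (f x : ℂ)) := by
        congr 1 with k
        rw [← fourierProfile_neg, fourierProfile, mul_left_comm, ← integral_mul_const]
        congr 1 with x
        rw [inner_neg_left, Complex.ofReal_neg, neg_mul_neg]
        ring
    _ = ∫ x, ∫ k, Complex.exp (Complex.I * (inner ℝ k x : ℝ)) *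
        ((fourierKernel u k * fourierProfile g k) * (f x : ℂ)) := integral_integral_swap hprod
    _ = ∫ x, (2 * Real.pi) ^ 3 * ((f x : ℂ) * ∫ y, (g y : ℂ) * u (x - y)) := by
        congr 1 with x
        have h1 := integral_fourierKernel_mul_fourierProfile (hu.comp_add_right x) g
        simp_rw [fourierKernel_translate] at h1
        have h3 := integral_neg_eq_self (fun y => u (y + x) * (g (-y) : ℂ)) volume
        simp only [neg_neg] at h3
        rw [mul_left_comm]
        have h2 : ∀ y, (g y : ℂ) * u (x - y) = u (-y + x) * g y := fun y => by
          rw [neg_add_eq_sub, mul_comm]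
        simp_rw [h2]
        rw [h3, ← h1, ← integral_const_mul]
        congr 1 with k
        ring
    _ = _ := integral_const_mul _ _

/-! ### Half-line Gaussian integrals and the error function -/

/-- An entire primitive makes the segment integrals in `erf` and the integrals along shifted half
lines differences of one function, replacing contour shifts. -/
theorem exists_primitive_cexp_neg_sq :
    ∃ F : ℂ → ℂ, ∀ z, HasDerivAt F (Complex.exp (-z ^ 2)) z := by
  have h : Differentiable ℂ fun z : ℂ => Complex.exp (-z ^ 2) := by fun_prop
  obtain ⟨F, hF⟩ := h.isExactOn_univ
  exact ⟨F, fun z => hF z (Set.mem_univ z)⟩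

theorem erf_neg (z : ℂ) : erf (-z) = -erf z := by simp [erf]

theorem erf_eq_primitive_sub {F : ℂ → ℂ} (hF : ∀ z, HasDerivAt F (Complex.exp (-z ^ 2)) z)
    (z : ℂ) : erf z = 2 / Real.sqrt Real.pi * (F z - F 0) := by
  have hd : ∀ s ∈ Set.uIcc (0 : ℝ) 1, HasDerivAt (fun s : ℝ => F (s * z))
      (z * Complex.exp (-(s * z) ^ 2)) s := by
    intro s _
    have h1 : HasDerivAt (fun s : ℝ => (s : ℂ) * z) z s := by
      simpa using (Complex.ofRealCLM.hasDerivAt (x := s)).mul_const z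
    exact (HasDerivAt.scomp s (hF (s * z)) h1)
  rw [erf, intervalIntegral.integral_eq_sub_of_hasDerivAt hd
    (Continuous.intervalIntegrable (by fun_prop) _ _)]
  simp

theorem tendsto_primitive_ofReal {F : ℂ → ℂ}
    (hF : ∀ z, HasDerivAt F (Complex.exp (-z ^ 2)) z) :
    Tendsto (fun R : ℝ => F R) atTop (𝓝 (F 0 + (Real.sqrt Real.pi / 2 : ℝ))) := by
  have hi : IntegrableOn (fun t : ℝ => Complex.exp (-(t : ℂ) ^ 2)) (Set.Ioi 0) := by
    have := (integrable_exp_neg_mul_sq one_pos).ofReal (𝕜 := ℂ)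
    refine Integrable.integrableOn (this.congr (Eventually.of_forall fun t => ?_))
    simp
  have h1 := intervalIntegral_tendsto_integral_Ioi 0 hi tendsto_id
  have h2 : ∫ t in Set.Ioi (0 : ℝ), Complex.exp (-(t : ℂ) ^ 2) = (Real.sqrt Real.pi / 2 : ℝ) := by
    have := integral_gaussian_Ioi 1
    rw [div_one] at this
    rw [← this, ← integral_complex_ofReal]
    congr 1 with t
    push_cast
    ring_nf
  have h3 : ∀ R : ℝ, ∫ t in (0 : ℝ)..R, Complex.exp (-(t : ℂ) ^ 2) = F R - F 0 := by
    intro R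
    rw [intervalIntegral.integral_eq_sub_of_hasDerivAt (f := fun t : ℝ => F t)
      (fun t _ => (hF t).comp_ofReal) (Continuous.intervalIntegrable (by fun_prop) _ _)]
    simp
  simp only [h2, h3, id] at h1
  have h4 := h1.const_add (F 0)
  simpa using h4

/-- On the closed ball of radius `‖z‖` around `R`, the imaginary part is at most `‖z‖` in size and
the real part is at least `R - ‖z‖ ≥ 0`. This bounds `|e^{-w²}|`, and the mean value inequality
applies. -/
theorem norm_primitive_sub_le {F : ℂ → ℂ}
    (hF : ∀ z, HasDerivAt F (Complex.exp (-z ^ 2)) z) (z : ℂ) {R : ℝ} (hR : ‖z‖ ≤ R) :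
    ‖F (R - z) - F R‖ ≤ Real.exp (‖z‖ ^ 2 - (R - ‖z‖) ^ 2) * ‖z‖ := by
  have h := Convex.norm_image_sub_le_of_norm_hasDerivWithin_le (f := F)
    (f' := fun w => Complex.exp (-w ^ 2)) (s := Metric.closedBall (R : ℂ) ‖z‖)
    (C := Real.exp (‖z‖ ^ 2 - (R - ‖z‖) ^ 2)) (x := R) (y := R - z)
    (fun w _ => (hF w).hasDerivWithinAt) (fun w hw => ?_) (convex_closedBall _ _)
    (by simp) (by simp)
  · simpa using h
  · rw [mem_closedBall_iff_norm] at hw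
    have h1 : |w.re - R| ≤ ‖z‖ := by
      have := (Complex.abs_re_le_norm (w - R)).trans hw
      simpa using this
    have h2 : |w.im| ≤ ‖z‖ := by
      have := (Complex.abs_im_le_norm (w - R)).trans hw
      simpa using this
    rw [Complex.norm_exp, Real.exp_le_exp]
    have h3 : (-w ^ 2).re = w.im ^ 2 - w.re ^ 2 := by
      rw [sq, Complex.neg_re, Complex.mul_re]; ring
    rw [h3]
    have h4 : w.im ^ 2 ≤ ‖z‖ ^ 2 := sq_le_sq' (abs_le.1 h2).1 (abs_le.1 h2).2
    have h5 : (R - ‖z‖) ^ 2 ≤ w.re ^ 2 :=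
      pow_le_pow_left₀ (by linarith) (by linarith [(abs_le.1 h1).1]) 2
    linarith

theorem tendsto_primitive_sub {F : ℂ → ℂ} (hF : ∀ z, HasDerivAt F (Complex.exp (-z ^ 2)) z)
    (z : ℂ) :
    Tendsto (fun R : ℝ => F (R - z)) atTop (𝓝 (F 0 + (Real.sqrt Real.pi / 2 : ℝ))) := by
  have h1 : Tendsto (fun R : ℝ => F (R - z) - F R) atTop (𝓝 0) := by
    have h2 : Tendsto (fun R : ℝ => Real.exp (‖z‖ ^ 2 - (R - ‖z‖) ^ 2) * ‖z‖) atTop (𝓝 0) := by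
      have h3 : Tendsto (fun R : ℝ => (R - ‖z‖) ^ 2) atTop atTop :=
        (tendsto_pow_atTop two_ne_zero).comp (tendsto_atTop_add_const_right _ (-‖z‖) tendsto_id)
      have h4 := (Real.tendsto_exp_atBot.comp
        (tendsto_atBot_add_const_left _ (‖z‖ ^ 2) (tendsto_neg_atTop_atBot.comp h3))).mul_const ‖z‖
      rw [zero_mul] at h4
      exact h4
    refine squeeze_zero_norm' ?_ h2
    filter_upwards [eventually_ge_atTop ‖z‖] with R hR
    exact norm_primitive_sub_le hF z hR
  have := h1.add (tendsto_primitive_ofReal hF)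
  simpa using this

theorem integrable_cexp_neg_sq {σ : ℝ} (hσ : 0 < σ) (z : ℂ) :
    Integrable fun k : ℝ => Complex.exp (-(σ * k - z) ^ 2) := by
  have hb : 0 < ((σ : ℂ) ^ 2).re := by
    rw [← Complex.ofReal_pow, Complex.ofReal_re]; positivity
  refine (integrable_cexp_quadratic hb (2 * σ * z) (-z ^ 2)).congr
    (Eventually.of_forall fun k => ?_)
  simp only
  congr 1
  ring

theorem integral_Ioi_cexp_neg_sq {σ : ℝ} (hσ : 0 < σ) (z : ℂ) :
    ∫ k in Set.Ioi (0 : ℝ), Complex.exp (-(σ * k - z) ^ 2) =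
      (Real.sqrt Real.pi / (2 * σ) : ℝ) * (1 + erf z) := by
  obtain ⟨F, hF⟩ := exists_primitive_cexp_neg_sq
  have hσ' : (σ : ℂ) ≠ 0 := by exact_mod_cast hσ.ne'
  have hs : (Real.sqrt Real.pi : ℂ) ≠ 0 := by exact_mod_cast (Real.sqrt_pos.2 Real.pi_pos).ne'
  have hd : ∀ k ∈ Set.Ici (0 : ℝ), HasDerivAt (fun k : ℝ => (1 / σ : ℂ) * F (σ * k - z))
      (Complex.exp (-(σ * k - z) ^ 2)) k := by
    intro k _
    have h1 : HasDerivAt (fun k : ℝ => (σ : ℂ) * k - z) σ k := by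
      simpa using ((Complex.ofRealCLM.hasDerivAt (x := k)).const_mul (σ : ℂ)).sub_const z
    refine ((HasDerivAt.scomp k (hF _) h1).const_mul (1 / σ : ℂ)).congr_deriv ?_
    rw [smul_eq_mul]
    field_simp
  have hlim : Tendsto (fun k : ℝ => (1 / σ : ℂ) * F (σ * k - z)) atTop
      (𝓝 ((1 / σ : ℂ) * (F 0 + (Real.sqrt Real.pi / 2 : ℝ)))) := by
    have h2 := (tendsto_primitive_sub hF z).comp (tendsto_id.const_mul_atTop hσ)
    refine (h2.const_mul _).congr fun k => ?_
    simp
  rw [integral_Ioi_of_hasDerivAt_of_tendsto' hd (integrable_cexp_neg_sq hσ z).integrableOn hlim,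
    Complex.ofReal_zero, mul_zero, zero_sub]
  -- The value at `k = 0` involves `F (-z)`; oddness about `F 0` is read off from `erf_neg`.
  have hodd : F (-z) - F 0 = -(F z - F 0) := by
    have h1 := erf_eq_primitive_sub hF z
    have h2 := erf_eq_primitive_sub hF (-z)
    have h3 := erf_neg z
    rw [h1, h2, ← mul_neg] at h3
    exact mul_left_cancel₀ (div_ne_zero two_ne_zero hs) h3
  have h4 : F (-z) = F 0 - (F z - F 0) := by rw [← neg_add_eq_sub, ← hodd]; ring
  rw [h4, erf_eq_primitive_sub hF z]
  push_cast
  field_simp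
  ring

theorem erf_conj (z : ℂ) : erf (conj z) = conj (erf z) := by
  rw [erf, erf, map_mul, intervalIntegral.integral_of_le zero_le_one,
    intervalIntegral.integral_of_le zero_le_one, ← integral_conj]
  congr 1
  · rw [map_div₀, Complex.conj_ofReal, map_ofNat]
  · congr 1 with s
    rw [map_mul, ← Complex.exp_conj, map_neg, map_pow, map_mul, Complex.conj_ofReal]

/-- On the imaginary axis `erf` is purely imaginary, and its integrand becomes the growing Gaussian
of Dawson's integral. -/
theorem dawson_ofReal (y : ℝ) :
    dawson y = (Real.exp (-y ^ 2) * (Real.sqrt Real.pi / 2) * (erf (Complex.I * y)).im : ℝ) := by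
  have hs : Real.sqrt Real.pi ≠ 0 := (Real.sqrt_pos.2 Real.pi_pos).ne'
  have h1 : ∀ s : ℝ, Complex.I * (y : ℂ) * Complex.exp (-(s * (Complex.I * y)) ^ 2) =
      Complex.I * ((y * Real.exp ((s * y) ^ 2) : ℝ) : ℂ) := by
    intro s
    rw [mul_left_comm, mul_pow, Complex.I_sq]
    push_cast
    ring_nf
  have h2 : ∀ s : ℝ, (y : ℂ) * Complex.exp ((s * y) ^ 2) =
      ((y * Real.exp ((s * y) ^ 2) : ℝ) : ℂ) := by
    intro s
    push_cast
    ring_nf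
  have h3 : erf (Complex.I * y) = ((2 / Real.sqrt Real.pi *
      ∫ s in (0 : ℝ)..1, y * Real.exp ((s * y) ^ 2) : ℝ) : ℂ) * Complex.I := by
    rw [erf]
    simp_rw [h1]
    rw [intervalIntegral.integral_const_mul, intervalIntegral.integral_ofReal]
    push_cast
    ring
  rw [h3, Complex.im_ofReal_mul, Complex.I_im, mul_one, dawson]
  simp_rw [h2]
  rw [intervalIntegral.integral_ofReal]
  push_cast
  field_simp

/-! ### Sine transforms of shifted Gaussians -/

theorem integral_Ioi_sin_mul_gaussian {σ : ℝ} (hσ : 0 < σ) (Ω x : ℝ) :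
    ∫ k in Set.Ioi (0 : ℝ), Real.sin (x * k) * Real.exp (-(σ ^ 2 * (k - Ω) ^ 2)) =
      Real.sqrt Real.pi / (2 * σ) * Real.exp (-(x / (2 * σ)) ^ 2) *
        (Complex.exp (Complex.I * Ω * x) *
          (1 + erf (Complex.I * (x / (2 * σ)) + Ω * σ))).im := by
  set z : ℂ := Complex.I * (x / (2 * σ)) + Ω * σ with hz
  have hσ' : (σ : ℂ) ≠ 0 := by exact_mod_cast hσ.ne'
  -- Completing the square: `ixk - σ²(k - Ω)² = iΩx - (x/2σ)² - (σk - z)²`.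
  have h1 : ∀ k : ℝ, Complex.exp (Complex.I * (x * k : ℝ)) *
      (Real.exp (-(σ ^ 2 * (k - Ω) ^ 2)) : ℝ) =
      (Complex.exp (Complex.I * Ω * x) * (Real.exp (-(x / (2 * σ)) ^ 2) : ℝ)) *
        Complex.exp (-(σ * k - z) ^ 2) := by
    intro k
    rw [Complex.ofReal_exp, Complex.ofReal_exp, ← Complex.exp_add, ← Complex.exp_add,
      ← Complex.exp_add]
    congr 1
    rw [hz]
    push_cast
    field_simp
    ring_nf
    simp only [Complex.I_sq]
    ring
  have h2 : ∀ k : ℝ, Real.sin (x * k) * Real.exp (-(σ ^ 2 * (k - Ω) ^ 2)) =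
      RCLike.im ((Complex.exp (Complex.I * Ω * x) * (Real.exp (-(x / (2 * σ)) ^ 2) : ℝ)) *
        Complex.exp (-(σ * k - z) ^ 2)) := by
    intro k
    rw [← h1, mul_comm Complex.I]
    change _ = Complex.im _
    rw [Complex.im_mul_ofReal, Complex.exp_ofReal_mul_I_im]
  have hi : IntegrableOn (fun k : ℝ => (Complex.exp (Complex.I * Ω * x) *
      (Real.exp (-(x / (2 * σ)) ^ 2) : ℝ)) * Complex.exp (-(σ * k - z) ^ 2)) (Set.Ioi 0) :=
    ((integrable_cexp_neg_sq hσ z).const_mul _).integrableOn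
  simp_rw [h2]
  rw [integral_im hi, integral_const_mul, integral_Ioi_cexp_neg_sq hσ z]
  change Complex.im _ = _
  rw [show Complex.exp (Complex.I * Ω * x) * (Real.exp (-(x / (2 * σ)) ^ 2) : ℝ) *
    ((Real.sqrt Real.pi / (2 * σ) : ℝ) * (1 + erf z)) =
      ((Real.sqrt Real.pi / (2 * σ) * Real.exp (-(x / (2 * σ)) ^ 2) : ℝ) : ℂ) *
        (Complex.exp (Complex.I * Ω * x) * (1 + erf z)) by push_cast; ring, Complex.im_ofReal_mul]

/-- Replacing `Ω` by `-Ω` sends `z` to `-conj z` and conjugates the phase, while `erf` is odd and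
commutes with conjugation. Against the `+Ω` version, the `erf` part keeps its sign and the sine
flips. -/
theorem im_cexp_mul_erf_neg (Ω σ x : ℝ) :
    (Complex.exp (Complex.I * (-Ω : ℝ) * x) *
        (1 + erf (Complex.I * (x / (2 * σ)) + (-Ω : ℝ) * σ))).im =
      (Complex.exp (Complex.I * Ω * x) * erf (Complex.I * (x / (2 * σ)) + Ω * σ)).im -
        Real.sin (Ω * x) := by
  set z : ℂ := Complex.I * (x / (2 * σ)) + Ω * σ with hz
  have h1 : Complex.I * (x / (2 * σ)) + (-Ω : ℝ) * σ = -conj z := by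
    rw [hz]
    simp [map_ofNat]
    ring
  have h2 : Complex.exp (Complex.I * (-Ω : ℝ) * x) = conj (Complex.exp (Complex.I * Ω * x)) := by
    rw [← Complex.exp_conj]
    simp
  have h3 : conj (Complex.exp (Complex.I * Ω * x)) * (1 - conj (erf z)) =
      conj (Complex.exp (Complex.I * Ω * x) - Complex.exp (Complex.I * Ω * x) * erf z) := by
    rw [map_sub, map_mul]; ring
  have h4 : (Complex.exp (Complex.I * Ω * x)).im = Real.sin (Ω * x) := by
    rw [show Complex.I * Ω * x = ((Ω * x : ℝ) : ℂ) * Complex.I by push_cast; ring,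
      Complex.exp_ofReal_mul_I_im]
  rw [h1, h2, erf_neg, erf_conj, ← sub_eq_add_neg, h3, Complex.conj_im, Complex.sub_im, h4]
  ring

theorem im_cexp_mul_one_add_erf (Ω σ x : ℝ) :
    (Complex.exp (Complex.I * Ω * x) * (1 + erf (Complex.I * (x / (2 * σ)) + Ω * σ))).im =
      (Complex.exp (Complex.I * Ω * x) * erf (Complex.I * (x / (2 * σ)) + Ω * σ)).im +
        Real.sin (Ω * x) := by
  have h4 : (Complex.exp (Complex.I * Ω * x)).im = Real.sin (Ω * x) := by
    rw [show Complex.I * Ω * x = ((Ω * x : ℝ) : ℂ) * Complex.I by push_cast; ring,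
      Complex.exp_ofReal_mul_I_im]
  rw [mul_add, mul_one, Complex.add_im, h4, add_comm]

/-- Split `k = (k + Ω) - Ω`: the first term is an exact derivative, and the second gives `1 +
erf(-σΩ)`, which is `erfc(σΩ)`. -/
theorem integral_Ioi_mul_gaussian {σ : ℝ} (hσ : 0 < σ) (Ω : ℝ) :
    ∫ k in Set.Ioi (0 : ℝ), (k : ℂ) * Complex.exp (-(σ ^ 2 * (Ω + k) ^ 2 : ℝ)) =
      1 / (2 * σ ^ 2) * (Complex.exp (-Ω ^ 2 * σ ^ 2) -
        Real.sqrt Real.pi * Ω * σ * erfc (σ * Ω)) := by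
  have hσ' : (σ : ℂ) ≠ 0 := by exact_mod_cast hσ.ne'
  have h1 := integral_Ioi_cexp_neg_sq hσ (-(σ * Ω))
  have hi1 := integrable_cexp_neg_sq hσ (-(σ * Ω))
  have he : ∀ k : ℝ, Complex.exp (-(σ * k - -(σ * Ω)) ^ 2) =
      (Real.exp (-(σ ^ 2 * (k + Ω) ^ 2)) : ℝ) := by
    intro k
    rw [Complex.ofReal_exp]
    congr 1
    push_cast
    ring
  simp_rw [he] at h1 hi1
  have hi2 : Integrable fun k : ℝ => (((k + Ω) * Real.exp (-(σ ^ 2 * (k + Ω) ^ 2)) : ℝ) : ℂ) := by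
    have := ((integrable_mul_exp_neg_mul_sq (b := σ ^ 2) (by positivity)).comp_add_right Ω).ofReal
      (𝕜 := ℂ)
    refine this.congr (Eventually.of_forall fun k => ?_)
    simp
  have h2 : ∫ k in Set.Ioi (0 : ℝ), (((k + Ω) * Real.exp (-(σ ^ 2 * (k + Ω) ^ 2)) : ℝ) : ℂ) =
      ((1 / (2 * σ ^ 2) * Real.exp (-(σ ^ 2 * Ω ^ 2)) : ℝ) : ℂ) := by
    have hi3 := hi2.re
    simp only [RCLike.re_to_complex, Complex.ofReal_re] at hi3
    rw [integral_complex_ofReal]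
    congr 1
    have hd : ∀ k ∈ Set.Ici (0 : ℝ), HasDerivAt
        (fun k : ℝ => -(1 / (2 * σ ^ 2)) * Real.exp (-(σ ^ 2 * (k + Ω) ^ 2)))
        ((k + Ω) * Real.exp (-(σ ^ 2 * (k + Ω) ^ 2))) k := by
      intro k _
      have h3 : HasDerivAt (fun k : ℝ => -(σ ^ 2 * (k + Ω) ^ 2)) (-(σ ^ 2 * (2 * (k + Ω)))) k := by
        have := ((((hasDerivAt_id k).add_const Ω).pow 2).const_mul (σ ^ 2)).neg
        refine this.congr_deriv ?_
        simp
      refine (h3.exp.const_mul _).congr_deriv ?_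
      field_simp
    have hl : Tendsto (fun k : ℝ => -(1 / (2 * σ ^ 2)) * Real.exp (-(σ ^ 2 * (k + Ω) ^ 2))) atTop
        (𝓝 0) := by
      have h3 : Tendsto (fun k : ℝ => σ ^ 2 * (k + Ω) ^ 2) atTop atTop :=
        ((tendsto_pow_atTop two_ne_zero).comp
          (tendsto_atTop_add_const_right _ Ω tendsto_id)).const_mul_atTop (by positivity)
      have h4 := (Real.tendsto_exp_atBot.comp (tendsto_neg_atTop_atBot.comp h3)).const_mul
        (-(1 / (2 * σ ^ 2)))
      rw [mul_zero] at h4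
      exact h4
    rw [integral_Ioi_of_hasDerivAt_of_tendsto' hd hi3.integrableOn hl]
    simp
  have h3 : ∀ k : ℝ, (k : ℂ) * Complex.exp (-(σ ^ 2 * (Ω + k) ^ 2 : ℝ)) =
      (((k + Ω) * Real.exp (-(σ ^ 2 * (k + Ω) ^ 2)) : ℝ) : ℂ) -
        Ω * (Real.exp (-(σ ^ 2 * (k + Ω) ^ 2)) : ℝ) := by
    intro k
    push_cast
    rw [add_comm (Ω : ℂ)]
    ring
  simp_rw [h3]
  rw [integral_sub hi2.integrableOn (hi1.const_mul _).integrableOn, integral_const_mul, h1, h2,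
    erf_neg, ← sub_eq_add_neg, ← erfc]
  push_cast
  rw [show (-(Ω : ℂ) ^ 2 * σ ^ 2) = -(σ ^ 2 * Ω ^ 2) by ring]
  field_simp

/-! ### Matrix elements as momentum integrals -/

theorem integral_norm_mul_spectralWeight_swap (h : ℝ → ℂ) (f g : 𝓢(Space, ℝ)) :
    ∫ k, h ‖k‖ * spectralWeight g f k = ∫ k, h ‖k‖ * spectralWeight f g k := by
  rw [← integral_neg_eq_self]
  simp only [spectralWeight_neg, norm_neg]

/-- The convention `Θ(0) = 1/2` makes this hold at `s = 0` as well. -/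
theorem heaviside_mul_add_heaviside_neg_mul (q : ℝ → ℂ) (s : ℝ) :
    heaviside s * q s + heaviside (-s) * q (-s) = q |s| := by
  rcases lt_trichotomy s 0 with hs | rfl | hs
  · simp [heaviside, hs, hs.not_gt, hs.ne, abs_of_neg hs]
  · simp [heaviside]
    ring
  · simp [heaviside, hs, hs.not_gt, hs.ne', abs_of_pos hs]

/-- A two-point kernel which is a superposition of modes with time dependence `q(|k| (t - t'))`. -/
structure IsModeSum (K : Detector → Detector → ℝ → ℝ → ℂ) (q : ℝ → ℂ) : Prop where
  eq_integral : ∀ A B t t', K A B t t' =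
    ∫ k, q (‖k‖ * (t - t')) * spectralWeight A.smearing B.smearing k
  continuous : Continuous q
  norm_le_one : ∀ θ, ‖q θ‖ ≤ 1

theorem isModeSum_wightman : IsModeSum wightman fun θ => Complex.exp (-Complex.I * θ) where
  eq_integral := wightman_eq
  continuous := by fun_prop
  norm_le_one θ := (norm_cexp_neg_I_mul θ).le

theorem isModeSum_wightmanSymm : IsModeSum wightmanSymm fun θ => Complex.cos θ where
  eq_integral := wightmanSymm_eq
  continuous := by fun_prop
  norm_le_one θ := by
    rw [← Complex.ofReal_cos, Complex.norm_real]
    exact Real.abs_cos_le_one θ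

theorem isModeSum_wightmanAnti :
    IsModeSum wightmanAnti fun θ => -Complex.I * Complex.sin θ where
  eq_integral := wightmanAnti_eq
  continuous := by fun_prop
  norm_le_one θ := by
    rw [norm_mul, norm_neg, Complex.norm_I, one_mul, ← Complex.ofReal_sin, Complex.norm_real]
    exact Real.abs_sin_le_one θ

section ModeSum

variable {K : Detector → Detector → ℝ → ℝ → ℂ} {q : ℝ → ℂ}

theorem IsModeSum.integrandC_eq (hK : IsModeSum K q) (Ω σ : ℝ) (f g : 𝓢(Space, ℝ)) :
    integrandC K (gaussianDetector Ω σ f) (gaussianDetector Ω σ g) =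
      fun p => switchC Ω σ p * ∫ k, q (‖k‖ * (p.1 - p.2)) * spectralWeight f g k := by
  funext p
  rw [integrandC, hK.eq_integral]
  rfl

/-- The reversed order carries the weight with `f` and `g` exchanged; `k ↦ -k` restores it, so both
orders are one function evaluated at `±(t - t')`. -/
theorem IsModeSum.integrandX_eq (hK : IsModeSum K q) (Ω σ : ℝ) (f g : 𝓢(Space, ℝ)) :
    integrandX K (gaussianDetector Ω σ f) (gaussianDetector Ω σ g) =
      fun p => switchX Ω σ p * ∫ k, q (‖k‖ * |p.1 - p.2|) * spectralWeight f g k := by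
  funext p
  rw [integrandX, hK.eq_integral, hK.eq_integral,
    integral_norm_mul_spectralWeight_swap (fun κ => q (κ * (p.2 - p.1))), ← neg_sub p.1 p.2]
  exact congrArg (switchX Ω σ p * ·) (heaviside_mul_add_heaviside_neg_mul
    (fun s => ∫ k, q (‖k‖ * s) * spectralWeight f g k) (p.1 - p.2))

theorem IsModeSum.integrable_integrandC (hK : IsModeSum K q) (Ω : ℝ) {σ : ℝ} (hσ : 0 < σ)
    (f g : 𝓢(Space, ℝ)) :
    Integrable (integrandC K (gaussianDetector Ω σ f) (gaussianDetector Ω σ g)) := by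
  rw [hK.integrandC_eq]
  have := hK.continuous
  exact integrable_superposition (Q := fun p κ => q (κ * (p.1 - p.2))) (integrable_switchC Ω hσ)
    (by fun_prop) (fun _ _ => hK.norm_le_one _) (integrable_spectralWeight f g)

theorem IsModeSum.integrable_integrandX (hK : IsModeSum K q) (Ω : ℝ) {σ : ℝ} (hσ : 0 < σ)
    (f g : 𝓢(Space, ℝ)) :
    Integrable (integrandX K (gaussianDetector Ω σ f) (gaussianDetector Ω σ g)) := by
  rw [hK.integrandX_eq]
  have := hK.continuous
  exact integrable_superposition (Q := fun p κ => q (κ * |p.1 - p.2|)) (integrable_switchX Ω hσ)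
    (by fun_prop) (fun _ _ => hK.norm_le_one _) (integrable_spectralWeight f g)

theorem IsModeSum.integral_integrandC (hK : IsModeSum K q) (Ω : ℝ) {σ : ℝ} (hσ : 0 < σ)
    (f g : 𝓢(Space, ℝ)) :
    ∫ p, integrandC K (gaussianDetector Ω σ f) (gaussianDetector Ω σ g) p =
      ∫ k, (∫ p : ℝ × ℝ, switchC Ω σ p * q (‖k‖ * (p.1 - p.2))) * spectralWeight f g k := by
  rw [hK.integrandC_eq]
  have := hK.continuous
  exact integral_superposition (Q := fun p κ => q (κ * (p.1 - p.2))) (integrable_switchC Ω hσ)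
    (by fun_prop) (fun _ _ => hK.norm_le_one _) (integrable_spectralWeight f g)

theorem IsModeSum.integral_integrandX (hK : IsModeSum K q) (Ω : ℝ) {σ : ℝ} (hσ : 0 < σ)
    (f g : 𝓢(Space, ℝ)) :
    ∫ p, integrandX K (gaussianDetector Ω σ f) (gaussianDetector Ω σ g) p =
      ∫ k, (∫ p : ℝ × ℝ, switchX Ω σ p * q (‖k‖ * |p.1 - p.2|)) * spectralWeight f g k := by
  rw [hK.integrandX_eq]
  have := hK.continuous
  exact integral_superposition (Q := fun p κ => q (κ * |p.1 - p.2|)) (integrable_switchX Ω hσ)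
    (by fun_prop) (fun _ _ => hK.norm_le_one _) (integrable_spectralWeight f g)

end ModeSum

/-! ### Pointlike limits of momentum integrals -/

theorem integrable_norm_div_norm {M : ℝ → ℂ}
    (hM : IntegrableOn (fun r : ℝ => (r : ℂ) * M r) (Set.Ioi 0)) :
    Integrable fun k : Space => M ‖k‖ / ‖k‖ := by
  refine (integrable_fun_norm_addHaar (volume : Measure Space) (f := fun r => M r / r)).2 ?_
  refine hM.congr_fun (fun r hr => ?_) measurableSet_Ioi
  have hr' : (r : ℂ) ≠ 0 := by exact_mod_cast (Set.mem_Ioi.1 hr).ne'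
  simp only [finrank_euclideanSpace, Fintype.card_fin, Complex.real_smul]
  push_cast
  field_simp

section Limits

variable {ι : Type*} {l : Filter ι} {F G : ι → 𝓢(Space, ℝ)}

theorem tendsto_integral_mul_spectralWeight_of_ne [l.IsCountablyGenerated] {a b : Space}
    (hab : a ≠ b) (hF : Tendsto F l (deltaFilter a)) (hG : Tendsto G l (deltaFilter b)) {M : ℝ → ℂ}
    (hM : Continuous M) (hMi : IntegrableOn (fun r : ℝ => (r : ℂ) * M r) (Set.Ioi 0)) :
    Tendsto (fun i => ∫ k, M ‖k‖ * spectralWeight (F i) (G i) k) l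
      (𝓝 (1 / (4 * Real.pi ^ 2 * dist a b) *
        ∫ r in Set.Ioi (0 : ℝ), (Real.sin (dist a b * r) : ℂ) * M r)) := by
  have hpi : (Real.pi : ℂ) ≠ 0 := by exact_mod_cast Real.pi_ne_zero
  convert tendsto_integral_mul_spectralWeight hF hG hM (integrable_norm_div_norm hMi) using 2
  -- The radial profile absorbs the relativistic factor `(2π)³ 2r`, so the Jacobian `r²` leaves the
  -- assumed integrable `r M(r)`.
  have h1 := integral_cexp_inner_mul_radial (R := fun r => M r / ((2 * Real.pi) ^ 3 * (2 * r) : ℝ))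
    (hM.measurable.div (by fun_prop)) ?_ (sub_ne_zero.2 hab)
  · have h2 : ∀ k : Space, M ‖k‖ * (Complex.exp (Complex.I * (inner ℝ k (a - b) : ℝ)) /
        ((2 * Real.pi) ^ 3 * (2 * ‖k‖) : ℝ)) = Complex.exp (Complex.I * (inner ℝ k (a - b) : ℝ)) *
        (M ‖k‖ / ((2 * Real.pi) ^ 3 * (2 * ‖k‖) : ℝ)) := fun k => by ring
    simp_rw [h2]
    rw [h1, ← dist_eq_norm, ← integral_const_mul, ← integral_const_mul]
    refine setIntegral_congr_fun measurableSet_Ioi fun r hr => ?_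
    have hr' : (r : ℂ) ≠ 0 := by exact_mod_cast (Set.mem_Ioi.1 hr).ne'
    have hd : (dist a b : ℂ) ≠ 0 := by exact_mod_cast (dist_pos.2 hab).ne'
    push_cast
    field_simp
    ring
  · have h3 : IntegrableOn (fun r : ℝ => (1 / (16 * Real.pi ^ 3) : ℂ) * ((r : ℂ) * M r))
        (Set.Ioi 0) := hMi.const_mul _
    refine h3.congr_fun (fun r hr => ?_) measurableSet_Ioi
    have hr' : (r : ℂ) ≠ 0 := by exact_mod_cast (Set.mem_Ioi.1 hr).ne'
    push_cast
    field_simp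
    ring

theorem tendsto_integral_mul_spectralWeight_self [l.IsCountablyGenerated] {a : Space}
    (hF : Tendsto F l (deltaFilter a)) {M : ℝ → ℂ} (hM : Continuous M)
    (hMi : IntegrableOn (fun r : ℝ => (r : ℂ) * M r) (Set.Ioi 0)) :
    Tendsto (fun i => ∫ k, M ‖k‖ * spectralWeight (F i) (F i) k) l
      (𝓝 (1 / (4 * Real.pi ^ 2) * ∫ r in Set.Ioi (0 : ℝ), (r : ℂ) * M r)) := by
  have hpi : (Real.pi : ℂ) ≠ 0 := by exact_mod_cast Real.pi_ne_zero
  convert tendsto_integral_mul_spectralWeight hF hF hM (integrable_norm_div_norm hMi) using 2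
  have h1 := integral_fun_norm_addHaar (volume : Measure Space)
    (fun r => M r * (1 / ((2 * Real.pi) ^ 3 * (2 * r) : ℝ)))
  -- The unit ball volume times the dimension 3 is the sphere's area `4π`.
  have hv : (volume : Measure Space).real (Metric.ball 0 1) = Real.pi * 4 / 3 := by
    rw [Measure.real, EuclideanSpace.volume_ball_fin_three]
    simp
    positivity
  simp only [sub_self, inner_zero_right, Complex.ofReal_zero, mul_zero, Complex.exp_zero]
  rw [h1, hv, finrank_euclideanSpace, Fintype.card_fin, nsmul_eq_mul, Complex.real_smul,
    ← integral_const_mul, ← integral_const_mul, ← integral_const_mul]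
  refine setIntegral_congr_fun measurableSet_Ioi fun r hr => ?_
  have hr' : (r : ℂ) ≠ 0 := by exact_mod_cast (Set.mem_Ioi.1 hr).ne'
  simp only [Complex.real_smul]
  push_cast
  field_simp
  ring

/-! ### The time-ordered commutator in position space -/

theorem integrable_relativeSwitch (Ω : ℝ) {σ : ℝ} (hσ : 0 < σ) :
    Integrable fun r : ℝ => ((r * relativeSwitch Ω σ r : ℝ) : ℂ) := by
  have h := ((integrable_mul_exp_neg_mul_sq (b := 1 / (4 * σ ^ 2)) (by positivity)).const_mul
    (1 / (2 * Real.sqrt Real.pi * σ) * Real.exp (-(σ ^ 2 * Ω ^ 2)))).ofReal (𝕜 := ℂ)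
  refine h.congr (Eventually.of_forall fun r => ?_)
  have he : r * relativeSwitch Ω σ r = 1 / (2 * Real.sqrt Real.pi * σ) *
      Real.exp (-(σ ^ 2 * Ω ^ 2)) * (r * Real.exp (-(1 / (4 * σ ^ 2)) * r ^ 2)) := by
    rw [relativeSwitch, sub_eq_add_neg, Real.exp_add,
      show -(1 / (4 * σ ^ 2)) * r ^ 2 = -(r ^ 2 / (4 * σ ^ 2)) by ring]
    ring
  exact congrArg (fun y : ℝ => (y : ℂ)) he.symm

/-- The position-space kernel of the time-ordered commutator contribution. -/
noncomputable def commutatorKernel (Ω σ : ℝ) (y : Space) : ℂ :=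
  relativeSwitch Ω σ ‖y‖ / ‖y‖

theorem integrable_commutatorKernel (Ω : ℝ) {σ : ℝ} (hσ : 0 < σ) :
    Integrable (commutatorKernel Ω σ) := by
  refine integrable_norm_div_norm (M := fun r => (relativeSwitch Ω σ r : ℂ)) ?_
  refine ((integrable_relativeSwitch Ω hσ).congr (Eventually.of_forall fun r => ?_)).integrableOn
  push_cast
  ring

/-- In the radial Fourier formula the factor `r` cancels the `1/r` of the kernel, leaving exactly
the half-line sine transform produced by the time-ordered commutator. -/
theorem fourierKernel_commutatorKernel (Ω : ℝ) {σ : ℝ} (hσ : 0 < σ) {k : Space} (hk : k ≠ 0) :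
    fourierKernel (commutatorKernel Ω σ) k = 4 * Real.pi / ‖k‖ *
      ∫ s in Set.Ioi (0 : ℝ), (relativeSwitch Ω σ s * Real.sin (‖k‖ * s) : ℂ) := by
  have hc := continuous_relativeSwitch Ω σ
  have h1 := integral_cexp_inner_mul_radial (R := fun r => (relativeSwitch Ω σ r : ℂ) / r)
    (by fun_prop) ?_ (neg_ne_zero.2 hk)
  · rw [norm_neg] at h1
    rw [fourierKernel]
    calc _ = ∫ y : Space, Complex.exp (Complex.I * (inner ℝ y (-k) : ℝ)) *
          ((relativeSwitch Ω σ ‖y‖ : ℂ) / ‖y‖) := by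
          congr 1 with y
          rw [inner_neg_right, real_inner_comm, commutatorKernel]
          push_cast
          ring_nf
      _ = _ := by
          rw [h1]
          congr 1
          refine setIntegral_congr_fun measurableSet_Ioi fun r hr => ?_
          have hr' : (r : ℂ) ≠ 0 := by exact_mod_cast (Set.mem_Ioi.1 hr).ne'
          field_simp
  · refine (integrable_relativeSwitch Ω hσ).integrableOn.congr_fun (fun r hr => ?_)
      measurableSet_Ioi
    have hr' : (r : ℂ) ≠ 0 := by exact_mod_cast (Set.mem_Ioi.1 hr).ne'
    push_cast
    field_simp

theorem integral_integrandX_wightmanAnti (Ω : ℝ) {σ : ℝ} (hσ : 0 < σ) (f g : 𝓢(Space, ℝ)) :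
    ∫ p, integrandX wightmanAnti (gaussianDetector Ω σ f) (gaussianDetector Ω σ g) p =
      -Complex.I / (4 * Real.pi) *
        ∫ x, (f x : ℂ) * ∫ y, (g y : ℂ) * commutatorKernel Ω σ (x - y) := by
  have hpi : (Real.pi : ℂ) ≠ 0 := by exact_mod_cast Real.pi_ne_zero
  have h1 := integral_fourierKernel_mul_conj_mul (integrable_commutatorKernel Ω hσ) f g
  have h2 : ∫ k, (∫ p : ℝ × ℝ, switchX Ω σ p *
      (-Complex.I * Complex.sin (‖k‖ * |p.1 - p.2| : ℝ))) * spectralWeight f g k =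
      -- The constant is `-2i / (16π³ · 4π)`: the sine integral's prefactor over those of the
      -- spectral weight and of the kernel's Fourier transform.
      -Complex.I / (32 * Real.pi ^ 4) * ∫ k, fourierKernel (commutatorKernel Ω σ) k *
        (conj (fourierProfile f k) * fourierProfile g k) := by
    rw [← integral_const_mul]
    refine integral_congr_ae ?_
    filter_upwards [(Measure.ae_ne volume (0 : Space))] with k hk
    have hk' : (‖k‖ : ℂ) ≠ 0 := by exact_mod_cast (norm_pos_iff.2 hk).ne'
    rw [integral_switchX_mul_sin_abs Ω hσ, fourierKernel_commutatorKernel Ω hσ hk, spectralWeight]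
    push_cast
    field_simp
    ring
  rw [isModeSum_wightmanAnti.integral_integrandX Ω hσ, h2, h1]
  field_simp
  ring

/-- The position-space formula is local, so the averaging estimate suffices, and countable
generation of `l` is not required. Distinct centres keep the limit point away from the singularity.
-/
theorem tendsto_integral_integrandX_wightmanAnti (Ω : ℝ) {σ : ℝ} (hσ : 0 < σ) {a b : Space}
    (hab : a ≠ b) (hF : Tendsto F l (deltaFilter a)) (hG : Tendsto G l (deltaFilter b)) :
    Tendsto (fun i => ∫ p, integrandX wightmanAnti (gaussianDetector Ω σ (F i))
      (gaussianDetector Ω σ (G i)) p) l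
      (𝓝 (-Complex.I / (4 * Real.pi) * (relativeSwitch Ω σ (dist a b) / dist a b))) := by
  simp_rw [integral_integrandX_wightmanAnti Ω hσ]
  have hc := continuous_relativeSwitch Ω σ
  have hm : Measurable (commutatorKernel Ω σ) := by
    unfold commutatorKernel
    fun_prop
  have hca : ContinuousAt (commutatorKernel Ω σ) (a - b) := by
    have h0 : (‖a - b‖ : ℂ) ≠ 0 := by exact_mod_cast (norm_pos_iff.2 (sub_ne_zero.2 hab)).ne'
    exact ContinuousAt.div (by fun_prop) (by fun_prop) h0
  have h := (tendsto_integral_integral_deltaFilter hF hG hm hca).const_mul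
    (-Complex.I / (4 * Real.pi))
  rwa [commutatorKernel, ← dist_eq_norm] at h

end Limits

/-! ### Closed forms -/

theorem continuous_cexp_gaussian (σ c : ℝ) :
    Continuous fun r : ℝ => Complex.exp (-(σ ^ 2 * (c + r) ^ 2 : ℝ)) := by
  fun_prop

theorem integrable_cexp_gaussian {σ : ℝ} (hσ : 0 < σ) (c : ℝ) :
    Integrable fun r : ℝ => Complex.exp (-(σ ^ 2 * (c + r) ^ 2 : ℝ)) := by
  refine (integrable_cexp_neg_sq hσ (-(σ * c))).congr (Eventually.of_forall fun r => ?_)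
  simp only
  congr 1
  push_cast
  ring

theorem integrable_mul_cexp_gaussian {σ : ℝ} (hσ : 0 < σ) (c : ℝ) :
    Integrable fun r : ℝ => (r : ℂ) * Complex.exp (-(σ ^ 2 * (c + r) ^ 2 : ℝ)) := by
  have h1 := ((integrable_mul_exp_neg_mul_sq (b := σ ^ 2) (by positivity)).comp_add_left c).ofReal
    (𝕜 := ℂ)
  refine (h1.sub ((integrable_cexp_gaussian hσ c).const_mul (c : ℂ))).congr
    (Eventually.of_forall fun r => ?_)
  simp
  ring

theorem integrable_sin_mul_cexp_gaussian {σ : ℝ} (hσ : 0 < σ) (c x : ℝ) :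
    Integrable fun r : ℝ =>
      (Real.sin (x * r) : ℂ) * Complex.exp (-(σ ^ 2 * (c + r) ^ 2 : ℝ)) := by
  refine (integrable_cexp_gaussian hσ c).bdd_mul (c := 1)
    (Continuous.aestronglyMeasurable (by fun_prop)) (Eventually.of_forall fun r => ?_)
  rw [Complex.norm_real]
  exact Real.abs_sin_le_one _

theorem integral_Ioi_sin_mul_cexp_gaussian {σ : ℝ} (hσ : 0 < σ) (c x : ℝ) :
    ∫ r in Set.Ioi (0 : ℝ), (Real.sin (x * r) : ℂ) * Complex.exp (-(σ ^ 2 * (c + r) ^ 2 : ℝ)) =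
      (Real.sqrt Real.pi / (2 * σ) * Real.exp (-(x / (2 * σ)) ^ 2) *
        (Complex.exp (Complex.I * (-c : ℝ) * x) *
          (1 + erf (Complex.I * (x / (2 * σ)) + (-c : ℝ) * σ))).im : ℝ) := by
  rw [← integral_Ioi_sin_mul_gaussian hσ, ← integral_complex_ofReal]
  congr 1 with r
  rw [sub_neg_eq_add, add_comm r c]
  push_cast
  ring

theorem pi_rpow_three_halves : Real.pi ^ (3 / 2 : ℝ) = Real.pi * Real.sqrt Real.pi := by
  rw [Real.sqrt_eq_rpow, show (3 / 2 : ℝ) = 1 + 1 / 2 by norm_num, Real.rpow_add Real.pi_pos,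
    Real.rpow_one]

section Limits

variable {ι : Type*} {l : Filter ι} {F G : ι → 𝓢(Space, ℝ)} {a b : Space}
  (lam Ω : ℝ) {σ : ℝ}

theorem tendsto_matrixP [l.IsCountablyGenerated] (hσ : 0 < σ) (hF : Tendsto F l (deltaFilter a)) :
    Tendsto (fun i => matrixP lam (gaussianDetector Ω σ (F i))) l (𝓝 (closedP lam Ω σ)) := by
  have hpi : (Real.pi : ℂ) ≠ 0 := by exact_mod_cast Real.pi_ne_zero
  have hσ' : (σ : ℂ) ≠ 0 := by exact_mod_cast hσ.ne'
  have h := (tendsto_integral_mul_spectralWeight_self hF (continuous_cexp_gaussian σ Ω)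
    (integrable_mul_cexp_gaussian hσ Ω).integrableOn).const_mul ((lam : ℂ) ^ 2)
  simp only [matrixP, isModeSum_wightman.integral_integrandC Ω hσ, integral_switchC_mul_phase Ω hσ]
  convert h using 2
  rw [integral_Ioi_mul_gaussian hσ, closedP]
  field_simp
  ring

/-- The Gaussians centred at `Ω` and `-Ω` are added: their sine terms cancel and the two equal `erf`
terms double. -/
theorem tendsto_matrixCplus [l.IsCountablyGenerated] (hσ : 0 < σ) (hab : a ≠ b)
    (hF : Tendsto F l (deltaFilter a))
    (hG : Tendsto G l (deltaFilter b)) :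
    Tendsto (fun i => matrixCplus lam (gaussianDetector Ω σ (F i)) (gaussianDetector Ω σ (G i))) l
      (𝓝 (closedCplus lam Ω σ (dist a b))) := by
  have hs : (Real.sqrt Real.pi : ℂ) ≠ 0 := by exact_mod_cast (Real.sqrt_pos.2 Real.pi_pos).ne'
  have hs2 : (Real.pi : ℂ) = Real.sqrt Real.pi ^ 2 := by
    rw [← Complex.ofReal_pow, Real.sq_sqrt Real.pi_pos.le]
  have hσ' : (σ : ℂ) ≠ 0 := by exact_mod_cast hσ.ne'
  have hd : (dist a b : ℂ) ≠ 0 := by exact_mod_cast (dist_pos.2 hab).ne'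
  have h := (tendsto_integral_mul_spectralWeight_of_ne hab hF hG
    (M := fun r => (1 / 2) * (Complex.exp (-(σ ^ 2 * (Ω + r) ^ 2 : ℝ)) +
      Complex.exp (-(σ ^ 2 * (-Ω + r) ^ 2 : ℝ)))) (by fun_prop) ?_).const_mul ((lam : ℂ) ^ 2)
  · simp only [matrixCplus, isModeSum_wightmanSymm.integral_integrandC Ω hσ,
      integral_switchC_mul_cos Ω hσ]
    convert h using 2
    · simp only [sq, ← neg_sub Ω, neg_mul_neg, neg_add_eq_sub]
    · have h1 : ∀ r : ℝ, (Real.sin (dist a b * r) : ℂ) * ((1 / 2) *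
          (Complex.exp (-(σ ^ 2 * (Ω + r) ^ 2 : ℝ)) + Complex.exp (-(σ ^ 2 * (-Ω + r) ^ 2 : ℝ)))) =
          (1 / 2) * ((Real.sin (dist a b * r) : ℂ) * Complex.exp (-(σ ^ 2 * (Ω + r) ^ 2 : ℝ)) +
            (Real.sin (dist a b * r) : ℂ) * Complex.exp (-(σ ^ 2 * (-Ω + r) ^ 2 : ℝ))) :=
        fun r => by ring
      simp_rw [h1]
      rw [integral_const_mul, integral_add (integrable_sin_mul_cexp_gaussian hσ _ _).integrableOn
        (integrable_sin_mul_cexp_gaussian hσ _ _).integrableOn,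
        integral_Ioi_sin_mul_cexp_gaussian hσ, integral_Ioi_sin_mul_cexp_gaussian hσ,
        im_cexp_mul_erf_neg, neg_neg, im_cexp_mul_one_add_erf, closedCplus, pi_rpow_three_halves]
      push_cast
      rw [hs2]
      field_simp
      ring
  · refine (((integrable_mul_cexp_gaussian hσ Ω).add
      (integrable_mul_cexp_gaussian hσ (-Ω))).const_mul (1 / 2)).integrableOn.congr_fun
      (fun r _ => ?_) measurableSet_Ioi
    simp only [Pi.add_apply]
    ring

/-- The same Gaussians are subtracted: the `erf` terms cancel, which is why the result is
elementary. -/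
theorem tendsto_matrixCminus [l.IsCountablyGenerated] (hσ : 0 < σ) (hab : a ≠ b)
    (hF : Tendsto F l (deltaFilter a))
    (hG : Tendsto G l (deltaFilter b)) :
    Tendsto (fun i => matrixCminus lam (gaussianDetector Ω σ (F i)) (gaussianDetector Ω σ (G i))) l
      (𝓝 (closedCminus lam Ω σ (dist a b))) := by
  have hs : (Real.sqrt Real.pi : ℂ) ≠ 0 := by exact_mod_cast (Real.sqrt_pos.2 Real.pi_pos).ne'
  have hs2 : (Real.pi : ℂ) = Real.sqrt Real.pi ^ 2 := by
    rw [← Complex.ofReal_pow, Real.sq_sqrt Real.pi_pos.le]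
  have hσ' : (σ : ℂ) ≠ 0 := by exact_mod_cast hσ.ne'
  have hd : (dist a b : ℂ) ≠ 0 := by exact_mod_cast (dist_pos.2 hab).ne'
  have h := (tendsto_integral_mul_spectralWeight_of_ne hab hF hG
    (M := fun r => (1 / 2) * (Complex.exp (-(σ ^ 2 * (Ω + r) ^ 2 : ℝ)) -
      Complex.exp (-(σ ^ 2 * (-Ω + r) ^ 2 : ℝ)))) (by fun_prop) ?_).const_mul ((lam : ℂ) ^ 2)
  · simp only [matrixCminus, isModeSum_wightmanAnti.integral_integrandC Ω hσ,
      integral_switchC_mul_sin Ω hσ]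
    convert h using 2
    · simp only [sq, ← neg_sub Ω, neg_mul_neg, neg_add_eq_sub]
    · have h1 : ∀ r : ℝ, (Real.sin (dist a b * r) : ℂ) * ((1 / 2) *
          (Complex.exp (-(σ ^ 2 * (Ω + r) ^ 2 : ℝ)) - Complex.exp (-(σ ^ 2 * (-Ω + r) ^ 2 : ℝ)))) =
          (1 / 2) * ((Real.sin (dist a b * r) : ℂ) * Complex.exp (-(σ ^ 2 * (Ω + r) ^ 2 : ℝ)) -
            (Real.sin (dist a b * r) : ℂ) * Complex.exp (-(σ ^ 2 * (-Ω + r) ^ 2 : ℝ))) :=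
        fun r => by ring
      simp_rw [h1]
      rw [integral_const_mul, integral_sub (integrable_sin_mul_cexp_gaussian hσ _ _).integrableOn
        (integrable_sin_mul_cexp_gaussian hσ _ _).integrableOn,
        integral_Ioi_sin_mul_cexp_gaussian hσ, integral_Ioi_sin_mul_cexp_gaussian hσ,
        im_cexp_mul_erf_neg, neg_neg, im_cexp_mul_one_add_erf, closedCminus, pi_rpow_three_halves]
      push_cast
      rw [hs2]
      field_simp
      ring
  · refine (((integrable_mul_cexp_gaussian hσ Ω).sub
      (integrable_mul_cexp_gaussian hσ (-Ω))).const_mul (1 / 2)).integrableOn.congr_fun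
      (fun r _ => ?_) measurableSet_Ioi
    simp only [Pi.sub_apply]
    ring

theorem tendsto_matrixXplus [l.IsCountablyGenerated] (hσ : 0 < σ) (hab : a ≠ b)
    (hF : Tendsto F l (deltaFilter a))
    (hG : Tendsto G l (deltaFilter b)) :
    Tendsto (fun i => matrixXplus lam (gaussianDetector Ω σ (F i)) (gaussianDetector Ω σ (G i))) l
      (𝓝 (closedXplus lam Ω σ (dist a b))) := by
  have hpi : (Real.pi : ℂ) ≠ 0 := by exact_mod_cast Real.pi_ne_zero
  have hσ' : (σ : ℂ) ≠ 0 := by exact_mod_cast hσ.ne'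
  have hd : (dist a b : ℂ) ≠ 0 := by exact_mod_cast (dist_pos.2 hab).ne'
  have h := (tendsto_integral_mul_spectralWeight_of_ne hab hF hG
    -- The Gaussian is centred at zero, written `0 + r` to match the shifted form. The argument of
    -- `erf` is then purely imaginary, which gives Dawson's function.
    (M := fun r => Complex.exp (-(σ ^ 2 * Ω ^ 2 : ℝ)) *
      Complex.exp (-(σ ^ 2 * (0 + r) ^ 2 : ℝ))) (by fun_prop) ?_).const_mul (-(lam : ℂ) ^ 2)
  -- Time ordering has no effect on the symmetric part, as cosine is even.
  · have habs : ∀ κ s : ℝ, Complex.cos (κ * |s| : ℝ) = Complex.cos (κ * s : ℝ) := by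
      intro κ s
      rcases abs_choice s with hs | hs <;> simp [hs]
    simp only [matrixXplus, isModeSum_wightmanSymm.integral_integrandX Ω hσ, habs,
      integral_switchX_mul_cos Ω hσ]
    convert h using 2
    · congr 2 with k
      rw [← Complex.exp_add]
      congr 2
      push_cast
      ring
    · have h1 : ∀ r : ℝ, (Real.sin (dist a b * r) : ℂ) * (Complex.exp (-(σ ^ 2 * Ω ^ 2 : ℝ)) *
          Complex.exp (-(σ ^ 2 * (0 + r) ^ 2 : ℝ))) = Complex.exp (-(σ ^ 2 * Ω ^ 2 : ℝ)) *
          ((Real.sin (dist a b * r) : ℂ) * Complex.exp (-(σ ^ 2 * (0 + r) ^ 2 : ℝ))) :=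
        fun r => by ring
      have h2 : (Complex.exp (Complex.I * (-0 : ℝ) * (dist a b : ℝ)) *
          (1 + erf (Complex.I * ((dist a b : ℝ) / (2 * σ)) + (-0 : ℝ) * σ))).im =
          (erf (Complex.I * (dist a b / (2 * σ) : ℝ))).im := by
        simp
      simp_rw [h1]
      rw [integral_const_mul, integral_Ioi_sin_mul_cexp_gaussian hσ, h2, closedXplus]
      have h3 := dawson_ofReal (dist a b / (2 * σ))
      rw [Complex.ofReal_div, Complex.ofReal_mul, Complex.ofReal_ofNat] at h3
      rw [h3, show (-(σ : ℂ) ^ 2 * Ω ^ 2) = -(σ ^ 2 * Ω ^ 2 : ℝ) by push_cast; ring]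
      push_cast
      field_simp
  · refine ((integrable_mul_cexp_gaussian hσ 0).const_mul
      (Complex.exp (-(σ ^ 2 * Ω ^ 2 : ℝ)))).integrableOn.congr_fun
      (fun r _ => ?_) measurableSet_Ioi
    simp only
    ring

theorem tendsto_matrixXminus (hσ : 0 < σ) (hab : a ≠ b) (hF : Tendsto F l (deltaFilter a))
    (hG : Tendsto G l (deltaFilter b)) :
    Tendsto (fun i => matrixXminus lam (gaussianDetector Ω σ (F i)) (gaussianDetector Ω σ (G i))) l
      (𝓝 (closedXminus lam Ω σ (dist a b))) := by
  have hs : (Real.sqrt Real.pi : ℂ) ≠ 0 := by exact_mod_cast (Real.sqrt_pos.2 Real.pi_pos).ne'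
  have hpi : (Real.pi : ℂ) ≠ 0 := by exact_mod_cast Real.pi_ne_zero
  have hσ' : (σ : ℂ) ≠ 0 := by exact_mod_cast hσ.ne'
  have hd : (dist a b : ℂ) ≠ 0 := by exact_mod_cast (dist_pos.2 hab).ne'
  have h := (tendsto_integral_integrandX_wightmanAnti Ω hσ hab hF hG).const_mul (-(lam : ℂ) ^ 2)
  simp only [matrixXminus]
  convert h using 2
  rw [closedXminus, relativeSwitch, pi_rpow_three_halves,
    show -(σ : ℂ) ^ 2 * Ω ^ 2 - ((dist a b : ℝ) / (2 * σ)) ^ 2 =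
      ((-(σ ^ 2 * Ω ^ 2) - dist a b ^ 2 / (4 * σ ^ 2) : ℝ) : ℂ) by push_cast; ring]
  push_cast
  field_simp
  ring

end Limits

/-! ### Splitting into symmetric and antisymmetric parts, and conclusion -/

theorem matrixC_eq_add (lam Ω : ℝ) {σ : ℝ} (hσ : 0 < σ) (f g : 𝓢(Space, ℝ)) :
    matrixC lam (gaussianDetector Ω σ f) (gaussianDetector Ω σ g) =
      matrixCplus lam (gaussianDetector Ω σ f) (gaussianDetector Ω σ g) +
        matrixCminus lam (gaussianDetector Ω σ f) (gaussianDetector Ω σ g) := by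
  rw [matrixC, matrixCplus, matrixCminus, ← mul_add, ← integral_add
    (isModeSum_wightmanSymm.integrable_integrandC Ω hσ f g)
    (isModeSum_wightmanAnti.integrable_integrandC Ω hσ f g)]
  congr 2 with p
  simp only [integrandC, ← wightmanSymm_add_wightmanAnti]
  ring

theorem matrixX_eq_add (lam Ω : ℝ) {σ : ℝ} (hσ : 0 < σ) (f g : 𝓢(Space, ℝ)) :
    matrixX lam (gaussianDetector Ω σ f) (gaussianDetector Ω σ g) =
      matrixXplus lam (gaussianDetector Ω σ f) (gaussianDetector Ω σ g) +
        matrixXminus lam (gaussianDetector Ω σ f) (gaussianDetector Ω σ g) := by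
  rw [matrixX, matrixXplus, matrixXminus, ← mul_add, ← integral_add
    (isModeSum_wightmanSymm.integrable_integrandX Ω hσ f g)
    (isModeSum_wightmanAnti.integrable_integrandX Ω hσ f g)]
  congr 2 with p
  simp only [integrandX, ← wightmanSymm_add_wightmanAnti]
  ring

theorem tendsto_eval_pointlike {N : ℕ} (pos : Fin N → Space) (i : Fin N) :
    Tendsto (fun f : Fin N → 𝓢(Space, ℝ) => f i) (pointlike pos) (deltaFilter (pos i)) :=
  tendsto_eval_pi _ i

instance pointlike_isCountablyGenerated {N : ℕ} (pos : Fin N → Space) :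
    (pointlike pos).IsCountablyGenerated := by
  unfold pointlike
  infer_instance

end UDW

theorem mainTheorem5 (N : ℕ) (pos : Fin N → UDW.Space) (lam Ω σ : ℝ) (hσ : 0 < σ) :
    -- the matrix elements of smeared detectors are absolutely convergent integrals
    (∀ f g : 𝓢(UDW.Space, ℝ),
      let A := UDW.gaussianDetector Ω σ f
      let B := UDW.gaussianDetector Ω σ g
      Integrable (UDW.integrandC UDW.wightman A B) ∧
      Integrable (UDW.integrandC UDW.wightmanSymm A B) ∧
      Integrable (UDW.integrandC UDW.wightmanAnti A B) ∧
      Integrable (UDW.integrandX UDW.wightman A B) ∧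
      Integrable (UDW.integrandX UDW.wightmanSymm A B) ∧
      Integrable (UDW.integrandX UDW.wightmanAnti A B)) ∧
    -- closed forms in the pointlike limit
    (∀ i, Tendsto (fun f => UDW.matrixP lam (UDW.gaussianDetector Ω σ (f i)))
      (UDW.pointlike pos) (𝓝 (UDW.closedP lam Ω σ))) ∧
    (∀ i j, pos i ≠ pos j →
      let x := dist (pos i) (pos j)
      let A := fun f : Fin N → 𝓢(UDW.Space, ℝ) => UDW.gaussianDetector Ω σ (f i)
      let B := fun f : Fin N → 𝓢(UDW.Space, ℝ) => UDW.gaussianDetector Ω σ (f j)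
      Tendsto (fun f => UDW.matrixCplus lam (A f) (B f)) (UDW.pointlike pos)
        (𝓝 (UDW.closedCplus lam Ω σ x)) ∧
      Tendsto (fun f => UDW.matrixCminus lam (A f) (B f)) (UDW.pointlike pos)
        (𝓝 (UDW.closedCminus lam Ω σ x)) ∧
      Tendsto (fun f => UDW.matrixC lam (A f) (B f)) (UDW.pointlike pos)
        (𝓝 (UDW.closedCplus lam Ω σ x + UDW.closedCminus lam Ω σ x)) ∧
      Tendsto (fun f => UDW.matrixXplus lam (A f) (B f)) (UDW.pointlike pos)
        (𝓝 (UDW.closedXplus lam Ω σ x)) ∧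
      Tendsto (fun f => UDW.matrixXminus lam (A f) (B f)) (UDW.pointlike pos)
        (𝓝 (UDW.closedXminus lam Ω σ x)) ∧
      Tendsto (fun f => UDW.matrixX lam (A f) (B f)) (UDW.pointlike pos)
        (𝓝 (UDW.closedXplus lam Ω σ x + UDW.closedXminus lam Ω σ x))) := by
  have hl := UDW.tendsto_eval_pointlike pos
  refine ⟨fun f g => ⟨UDW.isModeSum_wightman.integrable_integrandC Ω hσ f g,
    UDW.isModeSum_wightmanSymm.integrable_integrandC Ω hσ f g,
    UDW.isModeSum_wightmanAnti.integrable_integrandC Ω hσ f g,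
    UDW.isModeSum_wightman.integrable_integrandX Ω hσ f g,
    UDW.isModeSum_wightmanSymm.integrable_integrandX Ω hσ f g,
    UDW.isModeSum_wightmanAnti.integrable_integrandX Ω hσ f g⟩,
    fun i => UDW.tendsto_matrixP lam Ω hσ (hl i), fun i j hij => ?_⟩
  have hCp := UDW.tendsto_matrixCplus lam Ω hσ hij (hl i) (hl j)
  have hCm := UDW.tendsto_matrixCminus lam Ω hσ hij (hl i) (hl j)
  have hXp := UDW.tendsto_matrixXplus lam Ω hσ hij (hl i) (hl j)
  have hXm := UDW.tendsto_matrixXminus lam Ω hσ hij (hl i) (hl j)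
  refine ⟨hCp, hCm, ?_, hXp, hXm, ?_⟩
  · exact (hCp.add hCm).congr fun f => (UDW.matrixC_eq_add lam Ω hσ (f i) (f j)).symm
  · exact (hXp.add hXm).congr fun f => (UDW.matrixX_eq_add lam Ω hσ (f i) (f j)).symm
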